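/- Let $d,k\ge 1$ be integers with $k<2d-1$ and let $0<\epsilon<1$. Let $J_i=\left[\frac{2i-2}{2d-1},\frac{2i-1}{2d-1}\right]$, $i=1,\dots,d$, and let $f:\bigcup_i J_i\to[0,1]$ be the map with $f(J_i)=[0,1]$ for every $i$, with $f(x)=A\left((2d-1)x+x^{k+\epsilon}\right)$ on $J_1$ (the constant $A$ being chosen so that $f(J_1)=[0,1]$), and increasing and affine on each $J_i$, $i\ge 2$. **Conventions.** Let $\Sigma_d=\{1,\dots,d\}^{\mathbb N}$ with shift $\sigma$. An *embedding* is a topological embedding $h:\Sigma_d\to\mathbb R$ which is strictly increasing for the lexicographic order and whose image has convex hull $[0,1]$. A function on $\mathbb R$ is $C^r$, $r=n+a$ with $n$ an integer and $0<a\le 1$, if it is $C^n$ and its $n$-th derivative is locally $a$-Hölder (locally Lipschitz if $a=1$). The embedding $h$ (or the Cantor set $h(\Sigma_d)$) is $C^r$ if for each $i$ the map $h(\alpha)\mapsto h(i\alpha)$ extends to a $C^r$ map $g:\mathbb R\to\mathbb R$ with $0<g'\le K$ for some constant $K<1$. For a finite word put $I_{j_1\dots j_n}=h(\{\alpha:\alpha_1=j_n,\dots,\alpha_n=j_1\})$,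 and let $S(j_1\dots j_n)$ be the vector of the lengths of the convex hulls of the $d$ sets $I_{ij_1\dots j_n}$, $i=1,\dots,d$, and of the $d-1$ gaps between consecutive ones, all divided by the length of the convex hull of $I_{j_1\dots j_n}$. A function $S$ from the set $\Sigma_d^{dual}$ of infinite words $j=j_1j_2\dots$ to the simplex of points of $(0,1)^{2d-1}$ with coordinate sum $1$ is the *scaling function* of $h$ if $S(j)=\lim_n S(j_1\dots j_n)$ for every $j$. A *$C^r$ realization* of $S$ is a $C^r$ embedding whose scaling function is $S$. For such $S$ and $j\ne j'$ let $\rho_S(j,j')=\sup_w\prod_{t=1}^{n}S(j_{t+1}\dots j_nw)_{j_t}$, where $n$ is the length of the longest common initial word of $j$ and $j'$ and $w$ runs over the infinite words; let $\rho_S(j,j)=0$. Let $A(j)\subset[0,1]$ be the set of the $2d$ end points of the partition of $[0,1]$ into $d$ intervals and $d-1$ gaps, in alternating order, with the lengths $S(j)$. For finite sets $A_1,A_2\subset[0,1]$ let $D^k_{var}(M)(A_1,A_2)$ be the set of orientation preserving $C^k$ diffeomorphisms $\phi$ of $[0,1]$ with $\phi(A_1)=A_2$ and $\sup_{x,y}|D^k\phi(x)-D^k\phi(y)|\le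 M$. For $\phi$ with $\phi(A(j))=A(j')$ let $R_i\phi$ be the restriction of $\phi$ to the $i$-th interval determined by $S(j)$, which is mapped to the $i$-th interval determined by $S(j')$, with domain and range rescaled affinely to $[0,1]$. *Condition 2 for $k+e$* says: there is a constant $C$ such that, with $C(j,j')=C\rho_S(j,j')^{k+e-1}$, for all $j,j'\in\Sigma_d^{dual}$ and all $i=1,\dots,d$, $$D^k_{var}(C(ij,ij'))(A(ij),A(ij'))\cap R_i\left(D^k_{var}(C(j,j'))(A(j),A(j'))\right)\ne\emptyset .$$ **Claim.** Such $f$ exists. The set of points all of whose iterates under $f$ are defined is the image of an embedding $h$ with $f\circ h=h\circ\sigma$; this embedding is $C^{k+\epsilon}$, and it has a scaling function $S$. For every $\epsilon_1>\epsilon$, the function $S$ has no $C^{k+\epsilon_1}$ realization, and condition 2 for $k+\epsilon_1$ fails for $S$. -/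

import Mathlib

open Set Filter Topology

noncomputable section

namespace CantorScaling

/-! ### Symbol spaces

The symbols `1, …, d` are represented by `Fin d` (so the first symbol is `0`).  Infinite words are
functions `ℕ → Fin d`; both the space `Σ_d` and its dual consist of such words. -/

/-- Infinite words in `d` symbols. -/
abbrev Word (d : ℕ) : Type := ℕ → Fin d

/-- The shift map `σ(α₁α₂…) = α₂α₃…`. -/
def shift {d : ℕ} (α : Word d) : Word d := fun n => α (n + 1)

/-- The right-inverse `α₁α₂… ↦ iα₁α₂…` of the shift. -/
def prepend {d : ℕ} (i : Fin d) (α : Word d) : Word d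
  | 0 => i
  | n + 1 => α n

/-- The finite word `j₁…j_n` formed by the first `n` letters of `j`. -/
def initial {d : ℕ} (j : Word d) (n : ℕ) : List (Fin d) := (List.range n).map j

/-- The infinite word `j₁…j_n w`. -/
def splice {d : ℕ} (j : Word d) (n : ℕ) (w : Word d) : Word d :=
  fun m => if m < n then j m else w (m - n)

/-! ### Embeddings and their smoothness -/

/-- `h` is a topological embedding of `Σ_d` in `ℝ` with the standard (lexicographic) order, and the
convex hull of its image is the unit interval. -/
structure IsCantorEmbedding {d : ℕ} (h : Word d → ℝ) : Prop where
  isEmbedding : IsEmbedding h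
  lt_iff : ∀ α β : Word d, h β < h α ↔ ∃ m, (∀ l < m, α l = β l) ∧ β m < α m
  hull : convexHull ℝ (range h) = Icc 0 1

/-- `g : ℝ → ℝ` is of class `C^r`, where `r = n + a` with `n` an integer and `0 < a ≤ 1`: `g` is
`n` times continuously differentiable and its `n`-th derivative is `a`-Hölder on every bounded
interval (locally Lipschitz if `a = 1`). -/
def IsCr (r : ℝ) (g : ℝ → ℝ) : Prop :=
  ∃ (n : ℕ) (a : ℝ), 0 < a ∧ a ≤ 1 ∧ r = n + a ∧ ContDiff ℝ n g ∧
    ∀ R : ℝ, ∃ C : ℝ, ∀ x ∈ Icc (-R) R, ∀ y ∈ Icc (-R) R,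
      |iteratedDeriv n g x - iteratedDeriv n g y| ≤ C * |x - y| ^ a

/-- The embedding `h` is `C^r`: each right-inverse `h(α) ↦ h(iα)` of the induced shift map
extends to a `C^r` contraction of `ℝ` which is an orientation preserving diffeomorphism onto its
image. -/
def IsCrEmbedding {d : ℕ} (r : ℝ) (h : Word d → ℝ) : Prop :=
  ∀ i : Fin d, ∃ g : ℝ → ℝ, IsCr r g ∧ (∃ K < 1, ∀ x, 0 < deriv g x ∧ deriv g x ≤ K) ∧
    ∀ α, g (h α) = h (prepend i α)

/-! ### The scaling function -/

/-- The piece `I_{j₁…j_n} = h {α | α₁ = j_n, …, α_n = j₁}` of the image of `h`, for the finite word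
`l = j₁…j_n`. -/
def piece {d : ℕ} (h : Word d → ℝ) (l : List (Fin d)) : Set ℝ :=
  h '' {α | initial α l.length = l.reverse}

/-- Length of the convex hull of a nonempty bounded set of reals. -/
def hullLength (J : Set ℝ) : ℝ := sSup J - sInf J

/-- The `2d - 1` coordinates of a ratio geometry: `d` intervals, then `d - 1` gaps; the gap `g`
lies between the intervals `g` and `g + 1`. -/
abbrev Coord (d : ℕ) : Type := Fin d ⊕ Fin (d - 1)

/-- The ratio geometry `S(j₁…j_n)`: lengths of the intervals `I_{i j₁…j_n}` and of the gaps between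
consecutive ones, divided by the length of `I_{j₁…j_n}`. -/
def ratioGeometry {d : ℕ} (h : Word d → ℝ) (l : List (Fin d)) : Coord d → ℝ
  | .inl i => hullLength (piece h (i :: l)) / hullLength (piece h l)
  | .inr g =>
      (sInf (piece h (⟨g + 1, by omega⟩ :: l)) - sSup (piece h (⟨g, by omega⟩ :: l))) /
        hullLength (piece h l)

/-- The simplex of points of `(0,1)^{2d-1}` whose coordinates sum to one. -/
def Simp (d : ℕ) : Set (Coord d → ℝ) := {s | (∀ c, s c ∈ Ioo (0 : ℝ) 1) ∧ ∑ c, s c = 1}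

/-- `S`, a function on the dual Cantor set with values in the simplex, is the scaling function of
`h`: `S(j) = lim S(j₁…j_n)` for every infinite word `j`. -/
def IsScalingFunction {d : ℕ} (h : Word d → ℝ) (S : Word d → Coord d → ℝ) : Prop :=
  (∀ j, S j ∈ Simp d) ∧
    ∀ j, Tendsto (fun n => ratioGeometry h (initial j n)) atTop (𝓝 (S j))

/-- `S` has a `C^r` realization. -/
def HasRealization {d : ℕ} (r : ℝ) (S : Word d → Coord d → ℝ) : Prop :=
  ∃ h : Word d → ℝ, IsCantorEmbedding h ∧ IsCrEmbedding r h ∧ IsScalingFunction h S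

/-! ### The compatibility condition on a scaling function -/

open Classical in
/-- The metric `ρ_S(j, j') = sup_w ∏_{t=1}^n S(j_{t+1}…j_n w)_{j_t}`, where `n` is the length of the
longest common initial word of `j` and `j'`; it is `0` if `j = j'`. -/
def rho {d : ℕ} (S : Word d → Coord d → ℝ) (j j' : Word d) : ℝ :=
  if j = j' then 0 else
    ⨆ w : Word d, ∏ t ∈ Finset.range (PiNat.firstDiff j j'),
      S (shift^[t + 1] (splice j (PiNat.firstDiff j j') w)) (.inl (j t))

/-- Left end point of the `i`-th interval in the partition of `[0,1]` encoded by `s`. -/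
def leftEnd {d : ℕ} (s : Coord d → ℝ) (i : Fin d) : ℝ :=
  (∑ i' : Fin d with i' < i, s (.inl i')) +
    ∑ g : Fin (d - 1) with g.val < i.val, s (.inr g)

/-- Right end point of the `i`-th interval in the partition of `[0,1]` encoded by `s`. -/
def rightEnd {d : ℕ} (s : Coord d → ℝ) (i : Fin d) : ℝ := leftEnd s i + s (.inl i)

/-- The set of the `2d` end points of the partition of `[0,1]` encoded by `s`. -/
def endPoints {d : ℕ} (s : Coord d → ℝ) : Set ℝ := range (leftEnd s) ∪ range (rightEnd s)

/-- `φ` restricts to an orientation preserving `C^k` diffeomorphism of `[0,1]` which maps `A₁` onto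
`A₂` and whose `k`-th derivative varies by at most `M`. -/
structure IsDvar (k : ℕ) (M : ℝ) (A₁ A₂ : Set ℝ) (φ : ℝ → ℝ) : Prop where
  contDiffOn : ContDiffOn ℝ k φ (Icc 0 1)
  deriv_pos : ∀ x ∈ Icc (0 : ℝ) 1, 0 < derivWithin φ (Icc 0 1) x
  image_unit : φ '' Icc 0 1 = Icc 0 1
  image_points : φ '' A₁ = A₂
  variation : ∀ x ∈ Icc (0 : ℝ) 1, ∀ y ∈ Icc (0 : ℝ) 1,
    |iteratedDerivWithin k φ (Icc 0 1) x - iteratedDerivWithin k φ (Icc 0 1) y| ≤ M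

/-- The renormalization `R_i φ`: `φ` restricted to the `i`-th interval of the partition `s`, which it
maps to the `i`-th interval of the partition `s'`, both intervals being rescaled affinely to
`[0,1]`. -/
def renormalize {d : ℕ} (s s' : Coord d → ℝ) (i : Fin d) (φ : ℝ → ℝ) : ℝ → ℝ :=
  fun x => (φ (leftEnd s i + s (.inl i) * x) - leftEnd s' i) / s' (.inl i)

/-- There is a constant `C` such that, with `C(j,j') = C ρ_S(j,j')^{k+e-1}`, for all `j`, `j'` and
all symbols `i` the set
`D^k_var(C(ij,ij'))(A(ij),A(ij')) ∩ R_i (D^k_var(C(j,j'))(A(j),A(j')))` is nonempty. -/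
def RealizationCondition {d : ℕ} (k : ℕ) (e : ℝ) (S : Word d → Coord d → ℝ) : Prop :=
  ∃ C : ℝ, ∀ (j j' : Word d) (i : Fin d), ∃ φ : ℝ → ℝ,
    IsDvar k (C * rho S j j' ^ (k + e - 1)) (endPoints (S j)) (endPoints (S j')) φ ∧
    IsDvar k (C * rho S (prepend i j) (prepend i j') ^ (k + e - 1))
      (endPoints (S (prepend i j))) (endPoints (S (prepend i j')))
      (renormalize (S j) (S j') i φ)

/-! ### The example -/

/-- The interval `J_{i+1} = [2i/(2d-1), (2i+1)/(2d-1)]`, for `i = 0, …, d-1`. -/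
def branchInterval (d : ℕ) (i : Fin d) : Set ℝ :=
  Icc (2 * (i : ℝ) / (2 * d - 1)) ((2 * (i : ℝ) + 1) / (2 * d - 1))

/-- `f` (whose values outside the union of the `J_i` are irrelevant) maps every `J_i` onto `[0,1]`,
it is `A((2d-1)x + x^{k+ε})` on `J_1`, and increasing and affine on the other `J_i`. -/
structure IsExampleMap (d k : ℕ) (ε A : ℝ) (f : ℝ → ℝ) : Prop where
  image : ∀ i, f '' branchInterval d i = Icc 0 1
  first : ∀ i : Fin d, (i : ℕ) = 0 → ∀ x ∈ branchInterval d i,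
    f x = A * ((2 * d - 1) * x + x ^ ((k : ℝ) + ε))
  affine : ∀ i : Fin d, (i : ℕ) ≠ 0 → ∃ a b : ℝ, 0 < a ∧ ∀ x ∈ branchInterval d i, f x = a * x + b

/-- The Cantor set of `f`: the points all of whose iterates under `f : ⋃ J_i → [0,1]` are
defined. -/
def survivors (d : ℕ) (f : ℝ → ℝ) : Set ℝ := {x | ∀ n : ℕ, f^[n] x ∈ ⋃ i, branchInterval d i}

end CantorScaling

end

open CantorScaling

/-! Write D = 2d-1, s = k+ε, let z and o be the first two letters and T the inverse of f on J_1. The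
obstruction is read off at the words z…zooo… with n letters z (`witness`). The branch of o is
affine, so the end points of S there are T^n(b)/T^n(1), with b running over the 2d end points of the
J_i. Since f carries T^{n+1}(b) to T^n(b), the partition of the word with n+1 letters z goes to that
of the word with n letters by the rescaled f, x ↦ (x + βx^s)/(1+β), where β = Q^{s-1}/D and Q =
T^{n+1}(1). As 2d ≥ k+2, divided differences show that every C^k map with the same values at these
points has a k-th derivative of variation at least a constant times Q^{k+ε-1}
(`factor_mul_sub_le_of_variation_le`, `exists_variation_lower_bound`). Since Q → 0, such maps cannot
have variation O(Q^{k+e-1}) with e > ε (`IsExampleBranches.not_forall_exists_map`).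

Condition 2 would supply maps of that kind, because ρ_S of consecutive witnesses is O(Q): its
product telescopes and bounded distortion applies. A smoother realization would supply them too. In
the coordinate Φ linearizing its branch of o, the inverse of its branch of z is one map E of class
C^{k+a}, a = min(e,1) > ε, which carries the partition points at scale Z_{n+1} to those at scale
Z_n. Its rescalings have variation O(Z_{n+1}^{k+a-1}), and Z_n is proportional to T^n(1) because S
fixes the successive ratios of both. The analytic input is that a C^{k+a} contraction is linearized
in its own class (`HolderClass.exists_linearization`).

On the positive side, replacing x^s by x_+^s extends T to a C^{k+ε} contraction of the line;
contractions with ordered disjoint images of [0,1] code an embedding (`exists_isCodedBy`), and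
bounded distortion yields S (`IsCodedBy.exists_scalingFunction`). -/

namespace CantorScaling

/-! ### Functions of class `C^{n,a}` on the line -/

/-- `f` is `a`-Hölder on every bounded interval. -/
def LocHolder (a : ℝ) (f : ℝ → ℝ) : Prop :=
  ∀ R : ℝ, ∃ C : ℝ, ∀ x ∈ Icc (-R) R, ∀ y ∈ Icc (-R) R, |f x - f y| ≤ C * |x - y| ^ a

/-- `f` is `n` times differentiable, with locally `a`-Hölder `n`-th derivative. -/
def HolderClass (a : ℝ) : ℕ → (ℝ → ℝ) → Prop
  | 0, f => LocHolder a f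
  | n + 1, f => Differentiable ℝ f ∧ HolderClass a n (deriv f)

variable {a : ℝ} {f g : ℝ → ℝ} {n : ℕ}

theorem LocHolder.exists_bound (hf : LocHolder a f) (R : ℝ) :
    ∃ C : ℝ, 0 ≤ C ∧ ∀ x ∈ Icc (-R) R, ∀ y ∈ Icc (-R) R, |f x - f y| ≤ C * |x - y| ^ a := by
  obtain ⟨C, hC⟩ := hf R
  refine ⟨max C 0, le_max_right _ _, fun x hx y hy => (hC x hx y hy).trans ?_⟩
  gcongr
  exact le_max_left _ _

theorem LocHolder.continuous (ha : 0 < a) (hf : LocHolder a f) : Continuous f := by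
  rw [continuous_iff_continuousAt]
  intro x
  obtain ⟨C, hC0, hC⟩ := hf.exists_bound (|x| + 1)
  have h1 : Tendsto (fun y => C * |y - x| ^ a) (𝓝 x) (𝓝 0) := by
    have : Continuous fun y => C * |y - x| ^ a := by
      have := ha.le
      fun_prop (disch := assumption)
    exact this.tendsto' _ _ (by simp [Real.zero_rpow ha.ne'])
  rw [ContinuousAt, tendsto_iff_dist_tendsto_zero]
  refine squeeze_zero' (Eventually.of_forall fun _ => dist_nonneg) ?_ h1
  filter_upwards [Metric.ball_mem_nhds x one_pos] with y hy
  rw [Real.dist_eq]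
  rw [Metric.mem_ball, Real.dist_eq, abs_lt] at hy
  have := neg_abs_le x
  have := le_abs_self x
  exact hC y ⟨by linarith, by linarith⟩ x ⟨by linarith, by linarith⟩

theorem exists_abs_le_of_continuous (hf : Continuous f) (R : ℝ) :
    ∃ B : ℝ, 0 ≤ B ∧ ∀ x ∈ Icc (-R) R, |f x| ≤ B := by
  obtain ⟨B, hB⟩ := isCompact_Icc.exists_bound_of_continuousOn (s := Icc (-R) R) hf.continuousOn
  exact ⟨max B 0, le_max_right _ _, fun x hx => (hB x hx).trans (le_max_left _ _)⟩

theorem exists_lipschitz_of_locallyLipschitzOn {s : Set ℝ} (hs : IsCompact s)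
    (hf : LocallyLipschitzOn s f) :
    ∃ K : ℝ, 0 ≤ K ∧ ∀ x ∈ s, ∀ y ∈ s, |f x - f y| ≤ K * |x - y| := by
  obtain ⟨K, hK⟩ := hf.exists_lipschitzOnWith_of_compact hs
  exact ⟨K, K.2, fun x hx y hy => by simpa [Real.dist_eq] using hK.dist_le_mul x hx y hy⟩

theorem exists_lipschitz_of_contDiff (hf : ContDiff ℝ 1 f) (R : ℝ) :
    ∃ K : ℝ, 0 ≤ K ∧ ∀ x ∈ Icc (-R) R, ∀ y ∈ Icc (-R) R, |f x - f y| ≤ K * |x - y| :=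
  exists_lipschitz_of_locallyLipschitzOn isCompact_Icc
    (hf.contDiffOn.locallyLipschitzOn (convex_Icc _ _))

theorem abs_le_mul_abs_rpow (ha1 : a ≤ 1) {R u : ℝ} (hu : |u| ≤ R) :
    |u| ≤ R ^ (1 - a) * |u| ^ a := by
  rcases (abs_nonneg u).eq_or_lt with h | h
  · rw [← h]
    have : 0 ≤ R := (abs_nonneg u).trans hu
    positivity
  · calc |u| = |u| ^ (1 - a) * |u| ^ a := by rw [← Real.rpow_add h]; simp
      _ ≤ _ := by
        gcongr

theorem locHolder_of_contDiff (ha1 : a ≤ 1) (hf : ContDiff ℝ 1 f) : LocHolder a f := by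
  intro R
  obtain ⟨K, hK0, hK⟩ := exists_lipschitz_of_contDiff hf R
  refine ⟨K * (2 * R) ^ (1 - a), fun x hx y hy => (hK x hx y hy).trans ?_⟩
  rw [mul_assoc]
  gcongr
  refine abs_le_mul_abs_rpow ha1 (abs_le.2 ⟨?_, ?_⟩) <;> linarith [hx.1, hx.2, hy.1, hy.2]

theorem LocHolder.add (hf : LocHolder a f) (hg : LocHolder a g) :
    LocHolder a (fun x => f x + g x) := by
  intro R
  obtain ⟨C, hC⟩ := hf R
  obtain ⟨C', hC'⟩ := hg R
  refine ⟨C + C', fun x hx y hy => ?_⟩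
  have h1 := hC x hx y hy
  have h2 := hC' x hx y hy
  calc |f x + g x - (f y + g y)| = |(f x - f y) + (g x - g y)| := by ring_nf
    _ ≤ |f x - f y| + |g x - g y| := abs_add_le _ _
    _ ≤ _ := by linarith

theorem LocHolder.mul (ha : 0 < a) (hf : LocHolder a f) (hg : LocHolder a g) :
    LocHolder a (fun x => f x * g x) := by
  intro R
  obtain ⟨C, hC0, hC⟩ := hf.exists_bound R
  obtain ⟨C', hC0', hC'⟩ := hg.exists_bound R
  obtain ⟨B, hB0, hB⟩ := exists_abs_le_of_continuous (hf.continuous ha) R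
  obtain ⟨B', hB0', hB'⟩ := exists_abs_le_of_continuous (hg.continuous ha) R
  refine ⟨B * C' + C * B', fun x hx y hy => ?_⟩
  calc |f x * g x - f y * g y| = |f x * (g x - g y) + (f x - f y) * g y| := by ring_nf
    _ ≤ |f x| * |g x - g y| + |f x - f y| * |g y| := by
        rw [← abs_mul, ← abs_mul]; exact abs_add_le _ _
    _ ≤ B * (C' * |x - y| ^ a) + (C * |x - y| ^ a) * B' := by
        gcongr
        exacts [hB x hx, hC' x hx y hy, hC x hx y hy, hB' y hy]
    _ = _ := by ring

theorem LocHolder.comp (ha : 0 < a) (hf : LocHolder a f) (hg : ContDiff ℝ 1 g) :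
    LocHolder a (fun x => f (g x)) := by
  intro R
  obtain ⟨B, hB0, hB⟩ := exists_abs_le_of_continuous hg.continuous R
  obtain ⟨K, hK0, hK⟩ := exists_lipschitz_of_contDiff hg R
  obtain ⟨C, hC0, hC⟩ := hf.exists_bound B
  refine ⟨C * K ^ a, fun x hx y hy => ?_⟩
  calc |f (g x) - f (g y)| ≤ C * |g x - g y| ^ a :=
        hC _ (abs_le.1 (hB x hx)) _ (abs_le.1 (hB y hy))
    _ ≤ C * (K * |x - y|) ^ a := by gcongr; exact hK x hx y hy
    _ = _ := by rw [Real.mul_rpow hK0 (abs_nonneg _), mul_assoc]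

theorem LocHolder.smooth_comp (ha : 0 < a) {S : Set ℝ} (hS : Convex ℝ S) {ψ : ℝ → ℝ}
    (hψ : ContDiffOn ℝ 1 ψ S) (hf : LocHolder a f) (hfS : ∀ x, f x ∈ S) :
    LocHolder a (fun x => ψ (f x)) := by
  intro R
  have hcomp : IsCompact (f '' Icc (-R) R) := isCompact_Icc.image (hf.continuous ha)
  obtain ⟨K, hK0, hK⟩ := exists_lipschitz_of_locallyLipschitzOn hcomp
    ((hψ.locallyLipschitzOn hS).mono (by rintro _ ⟨x, -, rfl⟩; exact hfS x))
  obtain ⟨C, hC⟩ := hf R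
  refine ⟨K * C, fun x hx y hy => (hK _ ⟨x, hx, rfl⟩ _ ⟨y, hy, rfl⟩).trans ?_⟩
  rw [mul_assoc]
  gcongr
  exact hC x hx y hy

theorem HolderClass.continuous (ha : 0 < a) (hf : HolderClass a n f) : Continuous f := by
  cases n with
  | zero => exact LocHolder.continuous ha hf
  | succ n => exact hf.1.continuous

theorem HolderClass.contDiff (ha : 0 < a) (hf : HolderClass a n f) : ContDiff ℝ n f := by
  induction n generalizing f with
  | zero => simpa using (contDiff_zero (𝕜 := ℝ)).2 (hf.continuous ha)
  | succ n ih =>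
    have h : ContDiff ℝ ((n : WithTop ℕ∞) + 1) f :=
      contDiff_succ_iff_deriv.2 ⟨hf.1, by simp, ih hf.2⟩
    exact_mod_cast h

theorem HolderClass.contDiff_one (ha : 0 < a) (hf : HolderClass a (n + 1) f) : ContDiff ℝ 1 f :=
  (hf.contDiff ha).of_le (by norm_cast; omega)

theorem holderClass_iff (ha : 0 < a) :
    HolderClass a n f ↔ ContDiff ℝ n f ∧ LocHolder a (iteratedDeriv n f) := by
  induction n generalizing f with
  | zero =>
    simp only [HolderClass, iteratedDeriv_zero]
    exact ⟨fun h => ⟨contDiff_zero.2 (h.continuous ha), h⟩, fun h => h.2⟩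
  | succ n ih =>
    rw [HolderClass, ih, iteratedDeriv_succ', Nat.cast_add, Nat.cast_one, contDiff_succ_iff_deriv]
    simp [and_assoc]

theorem HolderClass.of_contDiff (ha1 : a ≤ 1) (hf : ContDiff ℝ (n + 1) f) : HolderClass a n f := by
  induction n generalizing f with
  | zero => exact locHolder_of_contDiff ha1 (by simpa using hf)
  | succ n ih =>
    have h := contDiff_succ_iff_deriv.1 hf
    exact ⟨h.1, ih (by exact_mod_cast h.2.2)⟩

theorem HolderClass.of_succ (ha : 0 < a) (ha1 : a ≤ 1) (hf : HolderClass a (n + 1) f) :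
    HolderClass a n f :=
  .of_contDiff ha1 (by exact_mod_cast hf.contDiff ha)

theorem HolderClass.of_le (ha : 0 < a) (ha1 : a ≤ 1) {m : ℕ} (hmn : m ≤ n)
    (hf : HolderClass a n f) : HolderClass a m f := by
  induction n, hmn using Nat.le_induction with
  | base => exact hf
  | succ n _ ih => exact ih (hf.of_succ ha ha1)

theorem HolderClass.add (hf : HolderClass a n f) (hg : HolderClass a n g) :
    HolderClass a n (fun x => f x + g x) := by
  induction n generalizing f g with
  | zero => exact LocHolder.add hf hg
  | succ n ih =>
    refine ⟨hf.1.add hg.1, ?_⟩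
    have : deriv (fun x => f x + g x) = fun x => deriv f x + deriv g x := by
      ext x; exact deriv_add (hf.1 x) (hg.1 x)
    rw [this]
    exact ih hf.2 hg.2

theorem HolderClass.mul (ha : 0 < a) (ha1 : a ≤ 1) (hf : HolderClass a n f)
    (hg : HolderClass a n g) : HolderClass a n (fun x => f x * g x) := by
  induction n generalizing f g with
  | zero => exact LocHolder.mul ha hf hg
  | succ n ih =>
    refine ⟨hf.1.mul hg.1, ?_⟩
    have : deriv (fun x => f x * g x) = fun x => deriv f x * g x + f x * deriv g x := by
      ext x; exact deriv_mul (hf.1 x) (hg.1 x)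
    rw [this]
    exact (ih hf.2 (hg.of_succ ha ha1)).add (ih (hf.of_succ ha ha1) hg.2)

theorem HolderClass.const (ha1 : a ≤ 1) (c : ℝ) : HolderClass a n (fun _ => c) :=
  .of_contDiff ha1 contDiff_const

theorem HolderClass.const_mul (ha : 0 < a) (ha1 : a ≤ 1) (c : ℝ) (hf : HolderClass a n f) :
    HolderClass a n (fun x => c * f x) :=
  (HolderClass.const ha1 c).mul ha ha1 hf

theorem HolderClass.sub (ha : 0 < a) (ha1 : a ≤ 1) (hf : HolderClass a n f)
    (hg : HolderClass a n g) : HolderClass a n (fun x => f x - g x) := by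
  simpa [sub_eq_add_neg] using hf.add (hg.const_mul ha ha1 (-1))

/-- The separate C^1 hypothesis on g matters at n = 0, where composing two a-Hölder functions would
only give the exponent a². -/
theorem HolderClass.comp (ha : 0 < a) (ha1 : a ≤ 1) (hf : HolderClass a n f)
    (hg : HolderClass a n g) (hg1 : ContDiff ℝ 1 g) : HolderClass a n (fun x => f (g x)) := by
  induction n generalizing f with
  | zero => exact LocHolder.comp ha hf hg1
  | succ n ih =>
    refine ⟨hf.1.comp hg.1, ?_⟩
    have : deriv (fun x => f (g x)) = fun x => deriv f (g x) * deriv g x := by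
      ext x; exact deriv_comp x (hf.1 _) (hg.1 x)
    rw [this]
    exact (ih hf.2 (hg.of_succ ha ha1)).mul ha ha1 hg.2

theorem HolderClass.smooth_comp (ha : 0 < a) (ha1 : a ≤ 1) {S : Set ℝ} (hS : Convex ℝ S)
    (hSo : IsOpen S) {ψ : ℝ → ℝ} (hψ : ContDiffOn ℝ (n + 1) ψ S) (hf : HolderClass a n f)
    (hfS : ∀ x, f x ∈ S) : HolderClass a n (fun x => ψ (f x)) := by
  induction n generalizing ψ with
  | zero => exact LocHolder.smooth_comp ha hS (by simpa using hψ) hf hfS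
  | succ n ih =>
    have h := (contDiffOn_succ_iff_deriv_of_isOpen hSo).1 hψ
    have hd : ∀ x, DifferentiableAt ℝ ψ (f x) := fun x =>
      (h.1 _ (hfS x)).differentiableAt (hSo.mem_nhds (hfS x))
    refine ⟨fun x => (hd x).comp x (hf.1 x), ?_⟩
    have : deriv (fun x => ψ (f x)) = fun x => deriv ψ (f x) * deriv f x := by
      ext x; exact deriv_comp x (hd x) (hf.1 x)
    rw [this]
    exact (ih (by exact_mod_cast h.2.2) (hf.of_succ ha ha1)).mul ha ha1 hf.2

theorem HolderClass.inv (ha : 0 < a) (ha1 : a ≤ 1) (hf : HolderClass a n f) (h0 : ∀ x, 0 < f x) :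
    HolderClass a n (fun x => (f x)⁻¹) :=
  hf.smooth_comp (ψ := fun x => x⁻¹) ha ha1 (convex_Ioi 0) isOpen_Ioi
    (fun _ hx => (contDiffAt_inv ℝ (ne_of_gt hx)).contDiffWithinAt) h0

theorem HolderClass.log (ha : 0 < a) (ha1 : a ≤ 1) (hf : HolderClass a n f) (h0 : ∀ x, 0 < f x) :
    HolderClass a n (fun x => Real.log (f x)) :=
  hf.smooth_comp ha ha1 (convex_Ioi 0) isOpen_Ioi
    (fun _ hx => (Real.contDiffAt_log.2 (ne_of_gt hx)).contDiffWithinAt) h0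

theorem HolderClass.exp (ha : 0 < a) (ha1 : a ≤ 1) (hf : HolderClass a n f) :
    HolderClass a n (fun x => Real.exp (f x)) :=
  hf.smooth_comp ha ha1 convex_univ isOpen_univ Real.contDiff_exp.contDiffOn fun _ => mem_univ _

theorem hasDerivAt_integral_of_continuous (hf : Continuous f) (x : ℝ) :
    HasDerivAt (fun u => ∫ t in (0 : ℝ)..u, f t) (f x) x :=
  intervalIntegral.integral_hasDerivAt_right (hf.intervalIntegrable _ _)
    (hf.stronglyMeasurableAtFilter _ _) hf.continuousAt

theorem HolderClass.of_hasDerivAt (hf : ∀ x, HasDerivAt f (g x) x) (hg : HolderClass a n g) :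
    HolderClass a (n + 1) f := by
  refine ⟨fun x => (hf x).differentiableAt, ?_⟩
  rwa [show deriv f = g from funext fun x => (hf x).deriv]

/-- A function of class `C^{n+1,a}` whose derivative is bounded away from zero has a global inverse
of the same class. -/
theorem HolderClass.exists_inverse (ha : 0 < a) (ha1 : a ≤ 1) (hf : HolderClass a (n + 1) f)
    {c : ℝ} (hc : 0 < c) (hfc : ∀ x, c ≤ deriv f x) :
    ∃ g, HolderClass a (n + 1) g ∧ (∀ x, g (f x) = x) ∧ (∀ y, f (g y) = y) ∧
      ∀ y, HasDerivAt g (deriv f (g y))⁻¹ y := by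
  have hmono : StrictMono f := strictMono_of_deriv_pos fun x => hc.trans_le (hfc x)
  have hgrow : ∀ x y, x ≤ y → c * (y - x) ≤ f y - f x := fun x y hxy =>
    (convex_univ (𝕜 := ℝ)).mul_sub_le_image_sub_of_le_deriv hf.1.continuous.continuousOn
      hf.1.differentiableOn (fun x _ => hfc x) x (mem_univ _) y (mem_univ _) hxy
  have hsurj : Function.Surjective f := by
    refine hf.1.continuous.surjective ?_ ?_
    · refine tendsto_atTop_mono' atTop (f₁ := fun x => f 0 + c * x) ?_ ?_
      · filter_upwards [eventually_ge_atTop 0] with x hx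
        linarith [hgrow 0 x hx]
      · exact tendsto_atTop_add_const_left _ _ (tendsto_id.const_mul_atTop hc)
    · refine tendsto_atBot_mono' atBot (f₁ := fun x => f 0 + c * x) ?_ ?_
      · filter_upwards [eventually_le_atBot 0] with x hx
        linarith [hgrow x 0 hx]
      · exact tendsto_atBot_add_const_left _ _ (tendsto_id.const_mul_atBot hc)
  let e := StrictMono.orderIsoOfSurjective f hmono hsurj
  let g : ℝ → ℝ := e.symm
  have hgf : ∀ x, g (f x) = x := fun x => e.symm_apply_apply x
  have hfg : ∀ y, f (g y) = y := fun y => e.apply_symm_apply y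
  have hgc : Continuous g := e.symm.continuous
  have hder : ∀ y, HasDerivAt g (deriv f (g y))⁻¹ y := fun y =>
    HasDerivAt.of_local_left_inverse hgc.continuousAt (hf.1 _).hasDerivAt
      (hc.trans_le (hfc _)).ne' (Eventually.of_forall hfg)
  have hg1 : ContDiff ℝ 1 g := by
    rw [contDiff_one_iff_deriv]
    refine ⟨fun y => (hder y).differentiableAt, ?_⟩
    rw [show deriv g = fun y => (deriv f (g y))⁻¹ from funext fun y => (hder y).deriv]
    exact ((HolderClass.continuous ha hf.2).comp hgc).inv₀ fun y => (hc.trans_le (hfc _)).ne'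
  refine ⟨g, ?_, hgf, hfg, hder⟩
  -- Bootstrap: g' = 1/(f'∘g), so g of class m gives g' of class m and g of class m+1; that g is C^1
  -- starts the induction.
  have key : ∀ m, m ≤ n + 1 → HolderClass a m g := by
    intro m
    induction m with
    | zero => exact fun _ => locHolder_of_contDiff ha1 hg1
    | succ m ih =>
      intro hm
      refine .of_hasDerivAt hder (HolderClass.inv ha ha1 ?_ fun y => hc.trans_le (hfc _))
      exact (HolderClass.of_le ha ha1 (by omega) hf.2).comp ha ha1 (ih (by omega)) hg1
  exact key _ le_rfl

/-- A smooth bounded function which is the identity on `[0,1]`. -/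
theorem exists_smooth_cutoff : ∃ (χ : ℝ → ℝ) (B : ℝ), (∀ n : ℕ, ContDiff ℝ n χ) ∧
    (∀ x, χ x ∈ Icc (-B) B) ∧ ∀ x ∈ Icc (0 : ℝ) 1, χ x = x := by
  let b : ContDiffBump (0 : ℝ) := ⟨1, 2, one_pos, one_lt_two⟩
  refine ⟨fun x => x * b x, 2, fun n => contDiff_id.mul b.contDiff, fun x => ?_, fun x hx => ?_⟩
  · rw [mem_Icc, ← abs_le, abs_mul, abs_of_nonneg b.nonneg]
    by_cases hx : |x| < 2
    · nlinarith [b.nonneg (x := x), b.le_one (x := x), abs_nonneg x]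
    · have : b x = 0 := b.zero_of_le_dist (by simpa [b, Real.dist_eq] using hx)
      simp [this]
  · have : b x = 1 := b.one_of_mem_closedBall (by
      simp [b, abs_le]; constructor <;> linarith [hx.1, hx.2])
    simp [this]

/-- A function of class `C^{n+1,a}` with positive derivative has a left inverse of the same class
over the image of the unit interval. -/
theorem HolderClass.exists_local_inverse (ha : 0 < a) (ha1 : a ≤ 1)
    (hf : HolderClass a (n + 1) f) (hpos : ∀ x, 0 < deriv f x) :
    ∃ g, HolderClass a (n + 1) g ∧ ∀ x ∈ Icc (0 : ℝ) 1, g (f x) = x := by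
  obtain ⟨χ, B, hχ, hχB, hχid⟩ := exists_smooth_cutoff
  have hf'c : Continuous (deriv f) := HolderClass.continuous ha hf.2
  have hχn : HolderClass a n χ := .of_contDiff ha1 (by exact_mod_cast hχ (n + 1))
  have hd : HolderClass a n (fun x => deriv f (χ x)) :=
    HolderClass.comp ha ha1 hf.2 hχn (by exact_mod_cast hχ 1)
  have hdc := hd.continuous ha
  -- Reading f' through the bounded map χ keeps it in a compact set of positive values, so F' is
  -- bounded below on the whole line, while F = f on [0,1].
  let F : ℝ → ℝ := fun x => f 0 + ∫ t in (0 : ℝ)..x, deriv f (χ t)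
  have hF : ∀ x, HasDerivAt F (deriv f (χ x)) x := fun x =>
    (hasDerivAt_integral_of_continuous hdc x).const_add _
  obtain ⟨z, -, hz⟩ := isCompact_Icc.exists_isMinOn (s := Icc (-B) B) ⟨χ 0, hχB 0⟩
    hf'c.continuousOn
  obtain ⟨g, hg, hgF, -, -⟩ := (HolderClass.of_hasDerivAt hF hd).exists_inverse ha ha1 (hpos z)
    (fun x => by rw [(hF x).deriv]; exact hz (hχB x))
  refine ⟨g, hg, fun x hx => ?_⟩
  have : F x = f x := by
    have h1 : ∫ t in (0 : ℝ)..x, deriv f (χ t) = ∫ t in (0 : ℝ)..x, deriv f t := by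
      refine intervalIntegral.integral_congr fun t ht => ?_
      rw [uIcc_of_le hx.1] at ht
      simp only [hχid t ⟨ht.1, ht.2.trans hx.2⟩]
    have h2 : ∫ t in (0 : ℝ)..x, deriv f t = f x - f 0 :=
      intervalIntegral.integral_eq_sub_of_hasDerivAt (fun t _ => (hf.1 t).hasDerivAt)
        (hf'c.intervalIntegrable _ _)
    simp only [F, h1, h2]
    ring
  rw [← this, hgF]

/-! ### The function `x₊^s` -/

/-- The power `x₊^s` of the positive part. -/
noncomputable def posPow (s x : ℝ) : ℝ := max x 0 ^ s

theorem posPow_of_nonneg {s x : ℝ} (hx : 0 ≤ x) : posPow s x = x ^ s := by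
  rw [posPow, max_eq_left hx]

theorem posPow_nonneg (s x : ℝ) : 0 ≤ posPow s x := Real.rpow_nonneg (le_max_right _ _) _

theorem continuous_posPow {s : ℝ} (hs : 0 < s) : Continuous (posPow s) :=
  (continuous_id.max continuous_const).rpow_const fun _ => Or.inr hs.le

theorem hasDerivAt_posPow {s : ℝ} (hs : 1 < s) (x : ℝ) :
    HasDerivAt (posPow s) (s * posPow (s - 1) x) x := by
  have hne : ∀ y ≠ 0, HasDerivAt (posPow s) (s * posPow (s - 1) y) y := by
    intro y hy
    rcases hy.lt_or_gt with hy | hy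
    · have : posPow (s - 1) y = 0 := by
        rw [posPow, max_eq_right hy.le, Real.zero_rpow (by linarith)]
      rw [this, mul_zero]
      refine (hasDerivAt_const y (0 : ℝ)).congr_of_eventuallyEq ?_
      filter_upwards [gt_mem_nhds hy] with z hz
      rw [posPow, max_eq_right hz.le, Real.zero_rpow (by linarith)]
    · rw [posPow_of_nonneg hy.le]
      refine (Real.hasDerivAt_rpow_const (Or.inl hy.ne')).congr_of_eventuallyEq ?_
      filter_upwards [lt_mem_nhds hy] with z hz
      rw [posPow_of_nonneg hz.le]
  rcases eq_or_ne x 0 with rfl | hx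
  · exact hasDerivAt_of_hasDerivAt_of_ne (g := fun y => s * posPow (s - 1) y) hne
      (continuous_posPow (by linarith)).continuousAt
      ((continuous_posPow (by linarith)).continuousAt.const_mul s)
  · exact hne x hx

/-- Subadditivity of u ↦ u^ε gives u^ε - v^ε ≤ (u-v)^ε, and taking positive parts is 1-Lipschitz. -/
theorem locHolder_posPow {ε : ℝ} (h0 : 0 < ε) (h1 : ε ≤ 1) : LocHolder ε (posPow ε) := by
  have key : ∀ u v : ℝ, 0 ≤ v → v ≤ u → u ^ ε - v ^ ε ≤ (u - v) ^ ε := fun u v hv huv => by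
    have := Real.rpow_add_le_add_rpow (sub_nonneg.2 huv) hv h0.le h1
    rw [sub_add_cancel] at this
    linarith
  have key' : ∀ x y : ℝ, y ≤ x → |posPow ε x - posPow ε y| ≤ |x - y| ^ ε := fun x y hxy => by
    have hm : max y 0 ≤ max x 0 := max_le_max hxy le_rfl
    have h2 : posPow ε y ≤ posPow ε x := Real.rpow_le_rpow (le_max_right _ _) hm h0.le
    rw [abs_of_nonneg (sub_nonneg.2 h2)]
    refine (key _ _ (le_max_right _ _) hm).trans ?_
    refine Real.rpow_le_rpow (sub_nonneg.2 hm) ?_ h0.le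
    have := abs_max_sub_max_le_abs x y 0
    exact (le_abs_self _).trans this
  intro R
  refine ⟨1, fun x _ y _ => ?_⟩
  rw [one_mul]
  rcases le_total y x with h | h
  · exact key' x y h
  · rw [abs_sub_comm, abs_sub_comm x y]
    exact key' y x h

theorem holderClass_posPow {ε : ℝ} (h0 : 0 < ε) (h1 : ε ≤ 1) (k : ℕ) :
    HolderClass ε k (posPow (k + ε)) := by
  induction k with
  | zero => simpa [HolderClass] using locHolder_posPow h0 h1
  | succ k ih =>
    have hk : (0 : ℝ) ≤ k := k.cast_nonneg
    refine .of_hasDerivAt (hasDerivAt_posPow (by push_cast; linarith)) ?_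
    refine HolderClass.const_mul h0 h1 _ ?_
    rwa [show ((k + 1 : ℕ) : ℝ) + ε - 1 = k + ε by push_cast; ring]

theorem iteratedDeriv_posPow {ε : ℝ} (h0 : 0 < ε) (k : ℕ) :
    ∃ c > 0, ∀ x, iteratedDeriv k (posPow (k + ε)) x = c * posPow ε x := by
  induction k with
  | zero => exact ⟨1, one_pos, by simp⟩
  | succ k ih =>
    obtain ⟨c, hc, h⟩ := ih
    have hk : (0 : ℝ) ≤ k := k.cast_nonneg
    refine ⟨(k + 1 + ε) * c, by positivity, fun x => ?_⟩
    have hd : deriv (posPow ((k + 1 : ℕ) + ε)) = fun x => (k + 1 + ε) * posPow (k + ε) x := by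
      ext x
      rw [(hasDerivAt_posPow (by push_cast; linarith) x).deriv]
      push_cast
      ring_nf
    rw [iteratedDeriv_succ', hd, iteratedDeriv_const_mul_field, h, mul_assoc]

/-- On (0,1) the derivative εx^{ε-1} is at least ε because ε ≤ 1. This growth of the k-th derivative
of `posPow (k + ε)` is what competing maps must reproduce. -/
theorem mul_sub_le_posPow_sub {ε : ℝ} (h0 : 0 < ε) (h1 : ε ≤ 1) {u v : ℝ} (hu : 0 ≤ u)
    (huv : u ≤ v) (hv : v ≤ 1) : ε * (v - u) ≤ posPow ε v - posPow ε u := by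
  refine (convex_Icc (0 : ℝ) 1).mul_sub_le_image_sub_of_le_deriv
    (continuous_posPow h0).continuousOn ?_ ?_ u ⟨hu, huv.trans hv⟩ v ⟨hu.trans huv, hv⟩ huv
  all_goals rw [interior_Icc]
  all_goals
    have hd : ∀ x ∈ Ioo (0 : ℝ) 1, HasDerivAt (posPow ε) (ε * x ^ (ε - 1)) x := fun x hx => by
      refine (Real.hasDerivAt_rpow_const (Or.inl hx.1.ne')).congr_of_eventuallyEq ?_
      filter_upwards [lt_mem_nhds hx.1] with z hz
      rw [posPow_of_nonneg hz.le]
  · exact fun x hx => (hd x hx).differentiableAt.differentiableWithinAt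
  · intro x hx
    rw [(hd x hx).deriv]
    exact le_mul_of_one_le_right h0.le
      (Real.one_le_rpow_of_pos_of_le_one_of_nonpos hx.1 hx.2.le (by linarith))

/-! ### Divided differences and the variation of the `k`-th derivative -/

/-- Iterated Rolle theorem: if `f` has `k + r + 1` zeros then its `k`-th derivative has `r + 1`. -/
theorem exists_zeros_iteratedDerivWithin (k r : ℕ) {f : ℝ → ℝ}
    (hf : ContDiffOn ℝ k f (Icc 0 1)) (x : ℕ → ℝ) (hx : ∀ i ≤ k + r, x i ∈ Icc (0 : ℝ) 1)
    (hmono : ∀ i < k + r, x i < x (i + 1)) (h0 : ∀ i ≤ k + r, f (x i) = 0) :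
    ∃ z : ℕ → ℝ, (∀ i ≤ r, z i ∈ Icc (0 : ℝ) 1) ∧ (∀ i < r, z i < z (i + 1)) ∧
      ∀ i ≤ r, iteratedDerivWithin k f (Icc 0 1) (z i) = 0 := by
  induction k generalizing f x with
  | zero => exact ⟨x, by simpa using hx, by simpa using hmono, by simpa using h0⟩
  | succ k ih =>
    -- Rolle's theorem between consecutive zeros; indices out of range receive the junk value 0.
    have hex : ∀ i, ∃ z, i ≤ k + r →
        z ∈ Ioo (x i) (x (i + 1)) ∧ derivWithin f (Icc 0 1) z = 0 := by
      intro i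
      by_cases hi : i ≤ k + r
      · have h1 := hx i (by omega)
        have h2 := hx (i + 1) (by omega)
        obtain ⟨z, hz, hz0⟩ := exists_deriv_eq_zero (hmono i (by omega))
          (hf.continuousOn.mono (Icc_subset_Icc h1.1 h2.2))
          ((h0 i (by omega)).trans (h0 (i + 1) (by omega)).symm)
        refine ⟨z, fun _ => ⟨hz, ?_⟩⟩
        rw [derivWithin_of_mem_nhds (Icc_mem_nhds (h1.1.trans_lt hz.1) (hz.2.trans_le h2.2)), hz0]
      · exact ⟨0, fun h => absurd h hi⟩
    choose z hz using hex
    have hd : ContDiffOn ℝ k (derivWithin f (Icc 0 1)) (Icc 0 1) :=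
      hf.derivWithin (uniqueDiffOn_Icc one_pos) (by norm_cast)
    obtain ⟨w, h1, h2, h3⟩ := ih hd z
      (fun i hi => ⟨(hx i (by omega)).1.trans (hz i hi).1.1.le,
        (hz i hi).1.2.le.trans (hx (i + 1) (by omega)).2⟩)
      (fun i hi => (hz i hi.le).1.2.trans (hz (i + 1) hi).1.1) (fun i hi => (hz i hi).2)
    exact ⟨w, h1, h2, fun i hi => by rw [iteratedDerivWithin_succ', h3 i hi]⟩

open Polynomial in
theorem iteratedDerivWithin_sub_eval (k : ℕ) {f : ℝ → ℝ} (hf : ContDiffOn ℝ k f (Icc 0 1))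
    (P : ℝ[X]) {x : ℝ} (hx : x ∈ Icc (0 : ℝ) 1) :
    iteratedDerivWithin k (fun t => f t - P.eval t) (Icc 0 1) x =
      iteratedDerivWithin k f (Icc 0 1) x - (derivative^[k] P).eval x := by
  have hu := uniqueDiffOn_Icc (zero_lt_one' ℝ)
  have hP : ContDiff ℝ k (fun t => P.eval t) := P.contDiff_aeval k
  have h1 := iteratedDerivWithin_sub hx hu (hf x hx) hP.contDiffWithinAt
  rw [show (fun t => f t - P.eval t) = f - fun t => P.eval t from rfl, h1, iteratedDerivWithin_eq_iteratedDeriv hu hP.contDiffAt hx]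
  congr 1
  clear h1 hP hf
  induction k generalizing P with
  | zero => simp
  | succ k ih =>
    rw [iteratedDeriv_succ', Function.iterate_succ_apply, ← ih]
    congr 1
    ext t
    exact P.deriv

open Polynomial in
theorem eval_iterate_derivative_of_natDegree_le (k : ℕ) {P : ℝ[X]} (hP : P.natDegree ≤ k + 1)
    (x : ℝ) : (derivative^[k] P).eval x = k.factorial * P.coeff k +
      (k + 1).factorial * P.coeff (k + 1) * x := by
  have hdeg : (derivative^[k] P).natDegree ≤ 1 := (P.natDegree_iterate_derivative k).trans (by omega)
  rw [eval_eq_sum_range' (n := 2) (by omega)]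
  simp only [Finset.sum_range_succ, Finset.sum_range_zero, coeff_iterate_derivative]
  have : (1 + k).descFactorial k = (k + 1).factorial := by
    rw [add_comm, Nat.descFactorial_eq_div (by omega)]
    simp
  rw [this, add_comm 1 k]
  simp [Nat.descFactorial_self]

open Polynomial in
-- Mean value theorem for divided differences: Rolle applied to `f - P`, whose k-th derivative
-- subtracts the constant k!·`P.coeff k`.
theorem exists_iteratedDerivWithin_eq_coeff (k : ℕ) {f : ℝ → ℝ}
    (hf : ContDiffOn ℝ k f (Icc 0 1)) {x : ℕ → ℝ} (hx : ∀ i ≤ k, x i ∈ Icc (0 : ℝ) 1)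
    (hmono : ∀ i < k, x i < x (i + 1)) {P : ℝ[X]} (hP : P.natDegree ≤ k)
    (h : ∀ i ≤ k, f (x i) = P.eval (x i)) :
    ∃ u ∈ Icc (0 : ℝ) 1, iteratedDerivWithin k f (Icc 0 1) u = k.factorial * P.coeff k := by
  obtain ⟨z, h1, -, h3⟩ := exists_zeros_iteratedDerivWithin k 0 (f := fun t => f t - P.eval t)
    (hf.sub (P.contDiff_aeval k).contDiffOn) x hx hmono (fun i hi => sub_eq_zero.2 (h i hi))
  refine ⟨z 0, h1 0 le_rfl, ?_⟩
  have := h3 0 le_rfl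
  rw [iteratedDerivWithin_sub_eval k hf P (h1 0 le_rfl),
    eval_iterate_derivative_of_natDegree_le k (by omega),
    coeff_eq_zero_of_natDegree_lt (n := k + 1) (by omega)] at this
  linarith

open Polynomial in
-- With one more node Rolle leaves two zeros of the k-th derivative of `f - P`, and that of P is
-- affine with slope (k+1)!·`P.coeff (k + 1)`. The top divided difference is thus a difference
-- quotient of the k-th derivative, and f need not have a derivative of order k+1.
theorem exists_iteratedDerivWithin_sub_eq_coeff (k : ℕ) {f : ℝ → ℝ}
    (hf : ContDiffOn ℝ k f (Icc 0 1)) {x : ℕ → ℝ} (hx : ∀ i ≤ k + 1, x i ∈ Icc (0 : ℝ) 1)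
    (hmono : ∀ i < k + 1, x i < x (i + 1)) {P : ℝ[X]} (hP : P.natDegree ≤ k + 1)
    (h : ∀ i ≤ k + 1, f (x i) = P.eval (x i)) :
    ∃ u ∈ Icc (0 : ℝ) 1, ∃ v ∈ Icc (0 : ℝ) 1, u < v ∧
      iteratedDerivWithin k f (Icc 0 1) v - iteratedDerivWithin k f (Icc 0 1) u =
        (k + 1).factorial * P.coeff (k + 1) * (v - u) := by
  obtain ⟨z, h1, h2, h3⟩ := exists_zeros_iteratedDerivWithin k 1 (f := fun t => f t - P.eval t)
    (hf.sub (P.contDiff_aeval k).contDiffOn) x hx hmono (fun i hi => sub_eq_zero.2 (h i hi))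
  refine ⟨z 0, h1 0 zero_le_one, z 1, h1 1 le_rfl, h2 0 one_pos, ?_⟩
  have e0 := h3 0 zero_le_one
  have e1 := h3 1 le_rfl
  rw [iteratedDerivWithin_sub_eval k hf P (h1 0 zero_le_one),
    eval_iterate_derivative_of_natDegree_le k hP] at e0
  rw [iteratedDerivWithin_sub_eval k hf P (h1 1 le_rfl),
    eval_iterate_derivative_of_natDegree_le k hP] at e1
  linarith

open Polynomial in
theorem exists_polynomial_eval_eq (k : ℕ) (x y : ℕ → ℝ) (hmono : ∀ i < k, x i < x (i + 1)) :
    ∃ P : ℝ[X], P.natDegree ≤ k ∧ ∀ i ≤ k, y i = P.eval (x i) := by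
  have hlt : ∀ i j, i < j → j ≤ k → x i < x j := by
    intro i j hij
    induction j, hij using Nat.le_induction with
    | base => exact fun h => hmono i h
    | succ j _ ih => exact fun h => (ih (by omega)).trans (hmono j (by omega))
  have hinj : Set.InjOn x (Finset.range (k + 1)) := by
    intro i hi j hj hij
    simp only [Finset.coe_range, mem_Iio] at hi hj
    rcases lt_trichotomy i j with h | h | h
    · exact absurd hij (hlt i j h (by omega)).ne
    · exact h
    · exact absurd hij (hlt j i h (by omega)).ne'
  refine ⟨Lagrange.interpolate (Finset.range (k + 1)) x y, ?_, fun i hi =>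
    (Lagrange.eval_interpolate_at_node y hinj (by simp; omega)).symm⟩
  refine natDegree_le_of_degree_le ((Lagrange.degree_interpolate_le y hinj).trans ?_)
  simp

open Polynomial in
/-- Two functions that agree at `k + 2` points: if the `k`-th derivative of one of them increases at
the rate `κ` at least, then the `k`-th derivative of the other cannot have small variation. -/
theorem factor_mul_sub_le_of_variation_le (k : ℕ) {f g : ℝ → ℝ}
    (hf : ContDiffOn ℝ k f (Icc 0 1)) (hg : ContDiffOn ℝ k g (Icc 0 1)) {x : ℕ → ℝ}
    (hx : ∀ i ≤ k + 1, x i ∈ Icc (0 : ℝ) 1) (hmono : ∀ i < k + 1, x i < x (i + 1))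
    (hfg : ∀ i ≤ k + 1, f (x i) = g (x i)) {κ M : ℝ}
    (hκ : ∀ u ∈ Icc (0 : ℝ) 1, ∀ v ∈ Icc (0 : ℝ) 1, u < v →
      κ * (v - u) ≤ iteratedDerivWithin k g (Icc 0 1) v - iteratedDerivWithin k g (Icc 0 1) u)
    (hM : ∀ u ∈ Icc (0 : ℝ) 1, ∀ v ∈ Icc (0 : ℝ) 1,
      |iteratedDerivWithin k f (Icc 0 1) u - iteratedDerivWithin k f (Icc 0 1) v| ≤ M) :
    κ * (x (k + 1) - x 0) ≤ (k + 1) * M := by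
  obtain ⟨P₁, hP₁, h₁⟩ := exists_polynomial_eval_eq k x (fun i => f (x i))
    (fun i hi => hmono i (by omega))
  obtain ⟨P₂, hP₂, h₂⟩ := exists_polynomial_eval_eq k (fun i => x (i + 1)) (fun i => f (x (i + 1)))
    (fun i hi => hmono (i + 1) (by omega))
  obtain ⟨u, hu, hu'⟩ := exists_iteratedDerivWithin_eq_coeff k hf (x := x)
    (fun i hi => hx i (by omega)) (fun i hi => hmono i (by omega)) hP₁ h₁
  obtain ⟨v, hv, hv'⟩ := exists_iteratedDerivWithin_eq_coeff k hf (x := fun i => x (i + 1))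
    (fun i hi => hx (i + 1) (by omega)) (fun i hi => hmono (i + 1) (by omega)) hP₂ h₂
  have hlt : ∀ j, j ≤ k → x 0 < x (j + 1) := by
    intro j
    induction j with
    | zero => exact fun h => hmono 0 (by omega)
    | succ j ih => exact fun h => (ih (by omega)).trans (hmono (j + 1) (by omega))
  have hl : 0 < x (k + 1) - x 0 := sub_pos.2 (hlt k le_rfl)
  set l := x (k + 1) - x 0 with hldef
  -- Aitken–Neville step: P₁ interpolates at the nodes 0,…,k and P₂ at 1,…,k+1, so P interpolates at
  -- all of them, and its top coefficient is the difference of those of P₂ and P₁ divided by l.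
  let P : ℝ[X] := C l⁻¹ * ((X - C (x 0)) * P₂ - (X - C (x (k + 1))) * P₁)
  have hPdeg : P.natDegree ≤ k + 1 := by
    refine (natDegree_C_mul_le _ _).trans ((natDegree_sub_le _ _).trans (max_le ?_ ?_))
    all_goals
      refine natDegree_mul_le.trans ?_
      rw [natDegree_X_sub_C]
      omega
  have hPcoeff : P.coeff (k + 1) = l⁻¹ * (P₂.coeff k - P₁.coeff k) := by
    simp only [P, coeff_C_mul, coeff_sub, sub_mul, coeff_X_mul,
      coeff_eq_zero_of_natDegree_lt (n := k + 1) (Nat.lt_succ_of_le hP₁),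
      coeff_eq_zero_of_natDegree_lt (n := k + 1) (Nat.lt_succ_of_le hP₂)]
    ring
  have hPeval : ∀ i ≤ k + 1, g (x i) = P.eval (x i) := by
    intro i hi
    rw [← hfg i hi]
    simp only [P, eval_mul, eval_sub, eval_C, eval_X]
    rcases Nat.eq_zero_or_pos i with rfl | hi0
    · rw [← h₁ 0 (by omega)]
      field_simp
      rw [hldef]
      ring
    · obtain ⟨m, rfl⟩ : ∃ m, i = m + 1 := ⟨i - 1, by omega⟩
      rw [← h₂ m (by omega)]
      rcases (show m ≤ k by omega).eq_or_lt with rfl | hmk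
      · field_simp
        rw [hldef]
        ring
      · rw [← h₁ (m + 1) (by omega)]
        field_simp
        rw [hldef]
        ring
  obtain ⟨p, hp, q, hq, hpq, hpq'⟩ := exists_iteratedDerivWithin_sub_eq_coeff k hg hx hmono hPdeg
    hPeval
  have hκ' := hκ p hp q hq hpq
  rw [hpq'] at hκ'
  -- For g the top divided difference is bounded below by the growth rate κ; for f the same number
  -- is, up to the factor (k+1)/l, a difference of two values of its k-th derivative.
  have h3 : κ ≤ (k + 1).factorial * P.coeff (k + 1) := le_of_mul_le_mul_right hκ' (sub_pos.2 hpq)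
  rw [hPcoeff, Nat.factorial_succ] at h3
  push_cast at h3
  have h4 := (le_abs_self _).trans (hM v hv u hu)
  rw [hv', hu'] at h4
  calc κ * l ≤ ((k + 1) * k.factorial * (l⁻¹ * (P₂.coeff k - P₁.coeff k))) * l := by gcongr
    _ = (k + 1) * (k.factorial * P₂.coeff k - k.factorial * P₁.coeff k) := by field_simp
    _ ≤ _ := by gcongr

/-- A map with `x ↦ (x + β x^{k+ε})/(1+β)` at `k + 2` points has a `k`-th derivative of variation
at least a constant times `β`. -/
theorem exists_variation_lower_bound (k : ℕ) (hk : 1 ≤ k) {ε : ℝ} (h0 : 0 < ε) (h1 : ε ≤ 1) :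
    ∃ c > 0, ∀ (β M : ℝ) (x : ℕ → ℝ) (φ : ℝ → ℝ), 0 ≤ β →
      ContDiffOn ℝ k φ (Icc 0 1) → (∀ i ≤ k + 1, x i ∈ Icc (0 : ℝ) 1) →
      (∀ i < k + 1, x i < x (i + 1)) →
      (∀ i ≤ k + 1, φ (x i) = (x i + β * x i ^ (k + ε)) / (1 + β)) →
      (∀ u ∈ Icc (0 : ℝ) 1, ∀ v ∈ Icc (0 : ℝ) 1,
        |iteratedDerivWithin k φ (Icc 0 1) u - iteratedDerivWithin k φ (Icc 0 1) v| ≤ M) →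
      c * (β / (1 + β)) * (x (k + 1) - x 0) ≤ M := by
  obtain ⟨c, hc, hcd⟩ := iteratedDeriv_posPow h0 k
  refine ⟨c * ε / (k + 1), by positivity, fun β M x φ hβ hφ hx hmono hval hM => ?_⟩
  have hβ1 : 0 < 1 + β := by linarith
  have hpc : ContDiff ℝ k (posPow (k + ε)) := (holderClass_posPow h0 h1 k).contDiff h0
  let g : ℝ → ℝ := fun t => (1 + β)⁻¹ * t + β / (1 + β) * posPow (k + ε) t
  have hg : ContDiff ℝ k g := (contDiff_const.mul contDiff_id).add (contDiff_const.mul hpc)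
  have hu := uniqueDiffOn_Icc (zero_lt_one' ℝ)
  -- Since k ≥ 1, the k-th derivative of the linear part is constant and drops out of differences.
  have hlin : ∀ u v : ℝ, iteratedDeriv k (fun t : ℝ => (1 + β)⁻¹ * t) u =
      iteratedDeriv k (fun t : ℝ => (1 + β)⁻¹ * t) v := by
    intro u v
    obtain ⟨m, rfl⟩ : ∃ m, k = m + 1 := ⟨k - 1, by omega⟩
    have hd : deriv (fun t : ℝ => (1 + β)⁻¹ * t) = fun _ => (1 + β)⁻¹ := by
      ext t
      simp
    rw [iteratedDeriv_succ', hd, iteratedDeriv_const, iteratedDeriv_const]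
  have hgd : ∀ t ∈ Icc (0 : ℝ) 1, iteratedDerivWithin k g (Icc 0 1) t =
      iteratedDeriv k (fun t : ℝ => (1 + β)⁻¹ * t) 0 + β / (1 + β) * (c * posPow ε t) := by
    intro t ht
    rw [iteratedDerivWithin_eq_iteratedDeriv hu hg.contDiffAt ht]
    have := iteratedDeriv_fun_add (n := k) (x := t) (f := fun t : ℝ => (1 + β)⁻¹ * t)
      (g := fun t => β / (1 + β) * posPow (k + ε) t)
      (contDiff_const.mul contDiff_id).contDiffAt (contDiff_const.mul hpc).contDiffAt
    rw [this, hlin t 0, iteratedDeriv_const_mul_field (β / (1 + β)), hcd]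
  have key := factor_mul_sub_le_of_variation_le k hφ hg.contDiffOn hx hmono (fun i hi => by
      rw [hval i hi]
      simp only [g, posPow_of_nonneg (hx i hi).1]
      field_simp) (κ := β / (1 + β) * (c * ε)) (M := M) (fun u hu v hv huv => by
      rw [hgd u hu, hgd v hv]
      have := mul_sub_le_posPow_sub h0 h1 hu.1 huv.le hv.2
      have h2 : β / (1 + β) * (c * (ε * (v - u))) ≤
          β / (1 + β) * (c * (posPow ε v - posPow ε u)) := by gcongr
      linarith) hM
  calc _ = β / (1 + β) * (c * ε) * (x (k + 1) - x 0) / (k + 1) := by ring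
    _ ≤ (k + 1) * M / (k + 1) := by gcongr
    _ = M := by field_simp

/-! ### Linearization of a contraction -/

section Linearization

variable {a : ℝ} {G : ℝ → ℝ} {K : ℝ}

theorem abs_iterate_sub_le (hK : 0 ≤ K) (hG : ∀ x y, |G x - G y| ≤ K * |x - y|) (t : ℕ) (x y : ℝ) :
    |G^[t] x - G^[t] y| ≤ K ^ t * |x - y| := by
  induction t with
  | zero => simp
  | succ t ih =>
    rw [Function.iterate_succ_apply', Function.iterate_succ_apply', pow_succ']
    calc _ ≤ K * |G^[t] x - G^[t] y| := hG _ _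
      _ ≤ K * (K ^ t * |x - y|) := by gcongr
      _ = _ := by ring

theorem tendsto_iterate_zero (hK : 0 ≤ K) (hK1 : K < 1) (hG : ∀ x y, |G x - G y| ≤ K * |x - y|)
    (hG0 : G 0 = 0) (x : ℝ) : Tendsto (fun t => G^[t] x) atTop (𝓝 0) := by
  have h0 : ∀ t, G^[t] 0 = 0 := fun t => Function.iterate_fixed hG0 t
  refine squeeze_zero_norm (a := fun t => K ^ t * |x|) (fun t => ?_) ?_
  · simpa [h0] using abs_iterate_sub_le hK hG t x 0
  · simpa using (tendsto_pow_atTop_nhds_zero_of_lt_one hK hK1).mul_const |x|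

theorem lipschitz_of_deriv_le (hGd : Differentiable ℝ G) (hpos : ∀ x, 0 < deriv G x)
    (hGK : ∀ x, deriv G x ≤ K) (x y : ℝ) : |G x - G y| ≤ K * |x - y| := by
  have := (convex_univ (𝕜 := ℝ)).norm_image_sub_le_of_norm_deriv_le (f := G) (C := K)
    (fun x _ => hGd x) (fun x _ => by rw [Real.norm_eq_abs, abs_of_pos (hpos x)]; exact hGK x)
    (mem_univ y) (mem_univ x)
  simpa using this

/-- The cohomological equation `U = b + c U∘G` over a contraction `G`. -/
theorem LocHolder.exists_solution (ha : 0 < a) (hK : 0 ≤ K) (hK1 : K < 1)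
    (hG : ∀ x y, |G x - G y| ≤ K * |x - y|) (hG0 : G 0 = 0) {b : ℝ → ℝ} (hb : LocHolder a b)
    (hb0 : b 0 = 0) {c : ℝ} (hc : |c| ≤ 1) :
    ∃ U, LocHolder a U ∧ U 0 = 0 ∧ ∀ x, U x = b x + c * U (G x) := by
  have h0 : ∀ t, G^[t] 0 = 0 := fun t => Function.iterate_fixed hG0 t
  have hKt : ∀ t, K ^ t ≤ 1 := fun t => pow_le_one₀ hK hK1.le
  have hct : ∀ t, |c ^ t| ≤ 1 := fun t => by
    rw [abs_pow]; exact pow_le_one₀ (abs_nonneg _) hc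
  have hmem : ∀ R, ∀ x ∈ Icc (-R) R, ∀ t, G^[t] x ∈ Icc (-R) R := fun R x hx t => by
    have h1 := abs_iterate_sub_le hK hG t x 0
    rw [h0, sub_zero, sub_zero] at h1
    have h2 : |x| ≤ R := abs_le.2 hx
    exact abs_le.1 (h1.trans ((mul_le_of_le_one_left (abs_nonneg _) (hKt t)).trans h2))
  have hq : K ^ a < 1 := Real.rpow_lt_one hK hK1 ha
  have hq0 : 0 ≤ K ^ a := Real.rpow_nonneg hK a
  have hterm : ∀ R, ∃ C, 0 ≤ C ∧ ∀ x ∈ Icc (-R) R, ∀ y ∈ Icc (-R) R, ∀ t,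
      |c ^ t * b (G^[t] x) - c ^ t * b (G^[t] y)| ≤ C * |x - y| ^ a * (K ^ a) ^ t := by
    intro R
    obtain ⟨C, hC0, hC⟩ := hb.exists_bound R
    refine ⟨C, hC0, fun x hx y hy t => ?_⟩
    rw [← mul_sub, abs_mul]
    calc _ ≤ 1 * |b (G^[t] x) - b (G^[t] y)| := by gcongr; exact hct t
      _ ≤ C * |G^[t] x - G^[t] y| ^ a := by
        rw [one_mul]; exact hC _ (hmem R x hx t) _ (hmem R y hy t)
      _ ≤ C * (K ^ t * |x - y|) ^ a := by gcongr; exact abs_iterate_sub_le hK hG t x y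
      _ = _ := by
        rw [Real.mul_rpow (by positivity) (abs_nonneg _), ← Real.rpow_natCast, ← Real.rpow_natCast,
          ← Real.rpow_mul hK, ← Real.rpow_mul hK, mul_comm (t : ℝ) a]
        ring
  have hsum : ∀ x, Summable fun t => c ^ t * b (G^[t] x) := by
    intro x
    obtain ⟨C, hC0, hC⟩ := hterm |x|
    refine Summable.of_norm_bounded ((summable_geometric_of_lt_one hq0 hq).mul_left (C * |x - 0| ^ a))
      fun t => ?_
    simpa [h0, hb0] using hC x ⟨neg_abs_le x, le_abs_self x⟩ 0 (by simp) t
  -- The solution is the series of c^t b∘G^t. Since b(0) = 0, its terms decay like (K^a)^t even when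
  -- |c| = 1, the case needed for the logarithm of a linearization.
  refine ⟨fun x => ∑' t, c ^ t * b (G^[t] x), ?_, by simp [h0, hb0], fun x => ?_⟩
  · intro R
    obtain ⟨C, hC0, hC⟩ := hterm R
    refine ⟨C * (1 - K ^ a)⁻¹, fun x hx y hy => ?_⟩
    rw [← (hsum x).tsum_sub (hsum y), ← Real.norm_eq_abs]
    refine (tsum_of_norm_bounded ((hasSum_geometric_of_lt_one hq0 hq).mul_left (C * |x - y| ^ a))
      fun t => hC x hx y hy t).trans (le_of_eq (by ring))
  · beta_reduce
    rw [(hsum x).tsum_eq_zero_add, ← tsum_mul_left]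
    simp only [pow_zero, one_mul, Function.iterate_zero, id]
    congr 1
    refine tsum_congr fun t => ?_
    rw [Function.iterate_succ_apply, pow_succ']
    ring

/-- Induction on smoothness by differentiating with respect to w dx: with Y' = wZ, the relation
w∘G·G' = μw turns the equation into Z = b'/w + cμ Z∘G, again with a constant coefficient and one
derivative less. Integrating Z back, with Y(0) = b(0)/(1-c), gives Y. -/
theorem HolderClass.exists_solution (ha : 0 < a) (ha1 : a ≤ 1) (hK : 0 ≤ K) (hK1 : K < 1)
    (hGd : Differentiable ℝ G) (hG : ∀ x y, |G x - G y| ≤ K * |x - y|) (hG0 : G 0 = 0)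
    {w : ℝ → ℝ} (hwpos : ∀ x, 0 < w x) {μ : ℝ} (hμ0 : 0 ≤ μ) (hμ1 : μ < 1)
    (hw : ∀ x, w (G x) * deriv G x = μ * w x) (m : ℕ) (hwm : HolderClass a m w) {b : ℝ → ℝ}
    (hb : HolderClass a m b) {c : ℝ} (hc : |c| < 1) :
    ∃ Y, HolderClass a m Y ∧ ∀ x, Y x = b x + c * Y (G x) := by
  have hc1 : 1 - c ≠ 0 := by linarith [(abs_lt.1 hc).2]
  induction m generalizing b c with
  | zero =>
    have h1 : LocHolder a fun x => b x + -b 0 := LocHolder.add hb (HolderClass.const (n := 0) ha1 _)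
    obtain ⟨U, hU, hU0, hUeq⟩ := h1.exists_solution ha hK hK1 hG hG0 (by simp) hc.le
    refine ⟨fun x => U x + b 0 / (1 - c),
      LocHolder.add hU (HolderClass.const (n := 0) ha1 _), fun x => ?_⟩
    simp only [hUeq x]
    field_simp
    ring
  | succ m ih =>
    have hwm' := hwm.of_succ ha ha1
    have hcμ : |c * μ| < 1 := by
      rw [abs_mul, abs_of_nonneg hμ0]
      nlinarith [abs_nonneg c]
    obtain ⟨Z, hZ, hZeq⟩ := ih hwm' (HolderClass.mul ha ha1 hb.2 (hwm'.inv ha ha1 hwpos)) hcμ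
      (by linarith [(abs_lt.1 hcμ).2])
    have hwZ := hwm'.mul ha ha1 hZ
    let Y : ℝ → ℝ := fun x => b 0 / (1 - c) + ∫ t in (0 : ℝ)..x, w t * Z t
    have hY : ∀ x, HasDerivAt Y (w x * Z x) x := fun x =>
      (hasDerivAt_integral_of_continuous (hwZ.continuous ha) x).const_add _
    refine ⟨Y, .of_hasDerivAt hY hwZ, fun x => ?_⟩
    let D : ℝ → ℝ := fun x => Y x - (b x + c * Y (G x))
    have hD : ∀ x, HasDerivAt D 0 x := fun x => by
      have h := (hY x).sub ((hb.1 x).hasDerivAt.add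
        (((hY (G x)).comp x (hGd x).hasDerivAt).const_mul c))
      refine HasDerivAt.congr_deriv h (Eq.symm ?_)
      have := hZeq x
      have h2 := hw x
      have h3 := (hwpos x).ne'
      calc (0 : ℝ) = w x * Z x - w x * (deriv b x * (w x)⁻¹ + c * μ * Z (G x)) := by
            rw [← this]; ring
        _ = w x * Z x - (deriv b x + c * (μ * w x) * Z (G x)) := by field_simp
        _ = _ := by rw [← h2]; ring
    have hD0 : D 0 = 0 := by
      simp only [D, Y, hG0, intervalIntegral.integral_same]
      field_simp
      ring
    have := is_const_of_deriv_eq_zero (fun x => (hD x).differentiableAt) (fun x => (hD x).deriv) x 0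
    rw [hD0] at this
    linarith

/-- A contraction of class `C^{n+1,a}` is linearized by a diffeomorphism of the same class. -/
theorem HolderClass.exists_linearization (ha : 0 < a) (ha1 : a ≤ 1) {n : ℕ} (hK1 : K < 1)
    (hG : HolderClass a (n + 1) G) (hpos : ∀ x, 0 < deriv G x) (hGK : ∀ x, deriv G x ≤ K)
    (hG0 : G 0 = 0) :
    ∃ Φ, HolderClass a (n + 1) Φ ∧ (∀ x, 0 < deriv Φ x) ∧ Φ 0 = 0 ∧
      ∀ x, Φ (G x) = deriv G 0 * Φ x := by
  have hK : 0 ≤ K := (hpos 0).le.trans (hGK 0)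
  have hlip := lipschitz_of_deriv_le hG.1 hpos hGK
  set μ := deriv G 0 with hμ
  have hμ0 : 0 < μ := hpos 0
  have hμ1 : μ < 1 := (hGK 0).trans_lt hK1
  -- Taking logarithms in Φ'(Gx)G'(x) = μΦ'(x), the function L = log Φ' has to satisfy L = l - l(0)
  -- + L∘G. The series solution is a priori only Hölder.
  let l : ℝ → ℝ := fun x => Real.log (deriv G x)
  have hl : HolderClass a n l := HolderClass.log ha ha1 hG.2 hpos
  have hb : HolderClass a n fun x => l x - l 0 := hl.sub ha ha1 (.const ha1 _)
  obtain ⟨L, hL, hL0, hLeq⟩ := LocHolder.exists_solution ha hK hK1 hlip hG0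
    (HolderClass.of_le ha ha1 (Nat.zero_le n) hb) (by simp) (c := 1) (by simp)
  simp only [one_mul] at hLeq
  have hLc := hL.continuous ha
  have hw : ∀ x, Real.exp (L (G x)) * deriv G x = μ * Real.exp (L x) := fun x => by
    have h1 : deriv G x = Real.exp (l x) := (Real.exp_log (hpos x)).symm
    have h2 : μ = Real.exp (l 0) := (Real.exp_log (hpos 0)).symm
    rw [h1, h2, ← Real.exp_add, ← Real.exp_add, hLeq x]
    ring_nf
  -- Bootstrap for L: once L is of class m, so is the weight w = e^L, and the differentiated
  -- equation Y = l'/w + μ Y∘G has a solution of class m. The integral M of wY is of class m+1 and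
  -- turns out to be L.
  have key : ∀ m ≤ n, HolderClass a m L := by
    intro m
    induction m with
    | zero => exact fun _ => hL
    | succ m ih =>
      intro hm
      have hwm : HolderClass a m fun x => Real.exp (L x) := (ih (by omega)).exp ha ha1
      have hlm : HolderClass a (m + 1) l := hl.of_le ha ha1 hm
      obtain ⟨Y, hY, hYeq⟩ := HolderClass.exists_solution ha ha1 hK hK1 hG.1 hlip hG0
        (fun x => Real.exp_pos (L x)) hμ0.le hμ1 hw m hwm
        (HolderClass.mul ha ha1 hlm.2 (hwm.inv ha ha1 fun x => Real.exp_pos (L x)))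
        (c := μ) (by rwa [abs_of_pos hμ0])
      have hwY := hwm.mul ha ha1 hY
      let M : ℝ → ℝ := fun x => ∫ t in (0 : ℝ)..x, Real.exp (L t) * Y t
      have hM : ∀ x, HasDerivAt M (Real.exp (L x) * Y x) x :=
        hasDerivAt_integral_of_continuous (hwY.continuous ha)
      have hMeq : ∀ x, M x = l x - l 0 + M (G x) := by
        intro x
        let D : ℝ → ℝ := fun x => M x - (l x + M (G x))
        have hD : ∀ x, HasDerivAt D 0 x := fun x => by
          have h := (hM x).sub ((hlm.1 x).hasDerivAt.add ((hM (G x)).comp x (hG.1 x).hasDerivAt))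
          refine HasDerivAt.congr_deriv h (Eq.symm ?_)
          have h3 := (Real.exp_pos (L x)).ne'
          calc (0 : ℝ) = Real.exp (L x) * Y x - Real.exp (L x) *
                (deriv l x * (Real.exp (L x))⁻¹ + μ * Y (G x)) := by rw [← hYeq x]; ring
            _ = Real.exp (L x) * Y x - (deriv l x + (μ * Real.exp (L x)) * Y (G x)) := by
                field_simp
            _ = _ := by rw [← hw x]; ring
        have := is_const_of_deriv_eq_zero (fun x => (hD x).differentiableAt)
          (fun x => (hD x).deriv) x 0
        simp only [D, M, hG0, intervalIntegral.integral_same] at this ⊢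
        linarith
      have hMc : Continuous M := continuous_iff_continuousAt.2 fun x => (hM x).continuousAt
      -- L - M is invariant under G and continuous, hence equal to its value at the attracting fixed
      -- point 0.
      have hinv : ∀ t x, L x - M x = L (G^[t] x) - M (G^[t] x) := by
        intro t x
        induction t with
        | zero => rfl
        | succ t iht =>
          rw [iht, Function.iterate_succ_apply', hLeq (G^[t] x), hMeq (G^[t] x)]
          ring
      have hLM : L = M := by
        ext x
        have h1 : Tendsto (fun t => L (G^[t] x) - M (G^[t] x)) atTop (𝓝 (L 0 - M 0)) :=
          ((hLc.sub hMc).tendsto 0).comp (tendsto_iterate_zero hK hK1 hlip hG0 x)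
        have h2 : L x - M x = L 0 - M 0 :=
          tendsto_nhds_unique (tendsto_const_nhds.congr fun t => hinv t x) h1
        simp only [hL0, M, intervalIntegral.integral_same] at h2 ⊢
        linarith
      rw [hLM]
      exact .of_hasDerivAt hM hwY
  have hwn : HolderClass a n fun x => Real.exp (L x) := (key n le_rfl).exp ha ha1
  let Φ : ℝ → ℝ := fun x => ∫ t in (0 : ℝ)..x, Real.exp (L t)
  have hΦ : ∀ x, HasDerivAt Φ (Real.exp (L x)) x :=
    hasDerivAt_integral_of_continuous (hwn.continuous ha)
  refine ⟨Φ, .of_hasDerivAt hΦ hwn, fun x => ?_, by simp [Φ], fun x => ?_⟩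
  · rw [(hΦ x).deriv]
    exact Real.exp_pos _
  · let D : ℝ → ℝ := fun x => Φ (G x) - μ * Φ x
    have hD : ∀ x, HasDerivAt D 0 x := fun x => by
      have h := ((hΦ (G x)).comp x (hG.1 x).hasDerivAt).sub ((hΦ x).const_mul μ)
      refine HasDerivAt.congr_deriv h (Eq.symm ?_)
      rw [hw x, sub_self]
    have := is_const_of_deriv_eq_zero (fun x => (hD x).differentiableAt)
      (fun x => (hD x).deriv) x 0
    simp only [D, Φ, hG0, intervalIntegral.integral_same] at this ⊢
    linarith

/-- The ratios of the distances of the iterates of points under a contraction converge to the ratios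
of the distances in the linearizing coordinate. -/
theorem HolderClass.exists_linearizing_coordinate (ha : 0 < a) (ha1 : a ≤ 1) {n : ℕ} (hK1 : K < 1)
    (hG : HolderClass a (n + 1) G) (hpos : ∀ x, 0 < deriv G x) (hGK : ∀ x, deriv G x ≤ K)
    {p : ℝ} (hGp : G p = p) :
    ∃ Φ, HolderClass a (n + 1) Φ ∧ (∀ x, 0 < deriv Φ x) ∧
      ∀ x y z w, z ≠ w → Tendsto (fun N => (G^[N] x - G^[N] y) / (G^[N] z - G^[N] w)) atTop
        (𝓝 ((Φ x - Φ y) / (Φ z - Φ w))) := by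
  have hadd : ∀ q : ℝ, HolderClass a (n + 1) fun x => x + q := fun q =>
    .of_contDiff ha1 (contDiff_id.add contDiff_const)
  have hadd1 : ∀ q : ℝ, ContDiff ℝ 1 fun x => x + q := fun q => contDiff_id.add contDiff_const
  -- Conjugation by a translation moves the fixed point to 0.
  let H : ℝ → ℝ := fun x => G (x + p) + -p
  have hHd : ∀ x, HasDerivAt H (deriv G (x + p)) x := fun x => by
    have h := (hG.1 (x + p)).hasDerivAt.comp_add_const x p
    exact h.add_const _
  have hH : HolderClass a (n + 1) H :=
    (hG.comp ha ha1 (hadd p) (hadd1 p)).add (.const ha1 _)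
  have hH0 : H 0 = 0 := by simp [H, hGp]
  have hHpos : ∀ x, 0 < deriv H x := fun x => by rw [(hHd x).deriv]; exact hpos _
  have hHK : ∀ x, deriv H x ≤ K := fun x => by rw [(hHd x).deriv]; exact hGK _
  obtain ⟨Ψ, hΨ, hΨpos, hΨ0, hΨeq⟩ := hH.exists_linearization ha ha1 hK1 hHpos hHK hH0
  set μ := deriv H 0
  have hμ0 : 0 < μ := hHpos 0
  have hK : 0 ≤ K := (hpos 0).le.trans (hGK 0)
  have hlip := lipschitz_of_deriv_le hH.1 hHpos hHK
  have hiter : ∀ N x, G^[N] x = H^[N] (x - p) + p := by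
    intro N x
    induction N with
    | zero => simp
    | succ N ih =>
      rw [Function.iterate_succ_apply', Function.iterate_succ_apply', ih]
      simp [H]
  have hΨiter : ∀ N x, Ψ (H^[N] x) = μ ^ N * Ψ x := by
    intro N x
    induction N with
    | zero => simp
    | succ N ih => rw [Function.iterate_succ_apply', hΨeq, ih, pow_succ']; ring
  -- By the mean value theorem H^N x - H^N y equals μ^N(Ψx - Ψy)/Ψ'(t) for some t that tends to 0
  -- with the iterates.
  have hlim : ∀ x y, Tendsto (fun N => (H^[N] x - H^[N] y) / μ ^ N) atTop
      (𝓝 ((Ψ x - Ψ y) / deriv Ψ 0)) := by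
    intro x y
    have hex : ∀ N, ∃ t, |t| ≤ |H^[N] x| + |H^[N] y| ∧
        deriv Ψ t * (H^[N] x - H^[N] y) = μ ^ N * (Ψ x - Ψ y) := by
      intro N
      have main : ∀ u v : ℝ, u < v → ∃ t, |t| ≤ |u| + |v| ∧ deriv Ψ t * (v - u) = Ψ v - Ψ u := by
        intro u v huv
        obtain ⟨t, ht, ht'⟩ := exists_deriv_eq_slope Ψ huv hΨ.1.continuous.continuousOn
          hΨ.1.differentiableOn
        refine ⟨t, abs_le.2 ⟨?_, ?_⟩, ?_⟩
        · linarith [ht.1, neg_abs_le u, abs_nonneg v]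
        · linarith [ht.2, le_abs_self v, abs_nonneg u]
        · rw [ht']
          field_simp [(sub_pos.2 huv).ne']
      rw [mul_sub, ← hΨiter, ← hΨiter]
      rcases lt_trichotomy (H^[N] x) (H^[N] y) with h | h | h
      · obtain ⟨t, h1, h2⟩ := main _ _ h
        exact ⟨t, h1, by linarith⟩
      · exact ⟨0, by rw [abs_zero]; positivity, by rw [h]; ring⟩
      · obtain ⟨t, h1, h2⟩ := main _ _ h
        exact ⟨t, by linarith, by linarith⟩
    choose t ht ht' using hex
    have htlim : Tendsto t atTop (𝓝 0) := by
      refine squeeze_zero_norm ht ?_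
      simpa using (tendsto_iterate_zero hK hK1 hlip hH0 x).abs.add
        (tendsto_iterate_zero hK hK1 hlip hH0 y).abs
    have hd : Tendsto (fun N => deriv Ψ (t N)) atTop (𝓝 (deriv Ψ 0)) :=
      ((HolderClass.continuous ha hΨ.2).tendsto 0).comp htlim
    refine (tendsto_const_nhds.div hd (hΨpos 0).ne').congr fun N => ?_
    rw [Pi.div_apply, div_eq_div_iff (hΨpos _).ne' (pow_pos hμ0 N).ne']
    linarith [ht' N]
  refine ⟨fun x => Ψ (x + -p), hΨ.comp ha ha1 (hadd _) (hadd1 _), fun x => ?_, ?_⟩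
  · rw [((hΨ.1 (x + -p)).hasDerivAt.comp_add_const x (-p)).deriv]
    exact hΨpos _
  · intro x y z w hzw
    have hinj : Function.Injective Ψ := (strictMono_of_deriv_pos hΨpos).injective
    have hne : (Ψ (z - p) - Ψ (w - p)) / deriv Ψ 0 ≠ 0 :=
      div_ne_zero (sub_ne_zero.2 fun h => hzw (by linarith [hinj h])) (hΨpos 0).ne'
    have h := (hlim (x - p) (y - p)).div (hlim (z - p) (w - p)) hne
    simp only [← sub_eq_add_neg]
    rw [div_div_div_cancel_right₀ (hΨpos 0).ne'] at h
    refine h.congr fun N => ?_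
    rw [Pi.div_apply, div_div_div_cancel_right₀ (pow_pos hμ0 N).ne', hiter, hiter, hiter, hiter]
    congr 1 <;> ring

end Linearization

/-! ### The end points of a ratio geometry -/

section EndPoints

variable {d : ℕ}

theorem leftEnd_zero (s : Coord d → ℝ) (h : 0 < d) : leftEnd s ⟨0, h⟩ = 0 := by
  have h1 : (Finset.univ.filter fun i' : Fin d => i' < ⟨0, h⟩) = ∅ := by
    ext x; simp [Fin.lt_def]
  simp [leftEnd, h1]

theorem leftEnd_succ (s : Coord d → ℝ) (i : ℕ) (h : i + 1 < d) :
    leftEnd s ⟨i + 1, h⟩ = rightEnd s ⟨i, by omega⟩ + s (.inr ⟨i, by omega⟩) := by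
  have h1 : (Finset.univ.filter fun i' : Fin d => i' < ⟨i + 1, h⟩) =
      insert ⟨i, by omega⟩ (Finset.univ.filter fun i' : Fin d => i' < ⟨i, by omega⟩) := by
    ext x; simp only [Finset.mem_filter_univ, Finset.mem_insert, Fin.lt_def, Fin.ext_iff]; omega
  have h2 : (Finset.univ.filter fun g : Fin (d - 1) => g.val < i + 1) =
      insert ⟨i, by omega⟩ (Finset.univ.filter fun g : Fin (d - 1) => g.val < i) := by
    ext x; simp only [Finset.mem_filter_univ, Finset.mem_insert, Fin.ext_iff]; omega
  rw [rightEnd, leftEnd, leftEnd, h1, h2, Finset.sum_insert (by simp), Finset.sum_insert (by simp)]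
  ring

theorem rightEnd_last (s : Coord d → ℝ) (h : d - 1 < d) : rightEnd s ⟨d - 1, h⟩ = ∑ c, s c := by
  have h1 : (Finset.univ : Finset (Fin d)) = insert ⟨d - 1, h⟩
      (Finset.univ.filter fun i' : Fin d => i' < ⟨d - 1, h⟩) := by
    ext x
    simp only [Finset.mem_univ, Finset.mem_insert, Finset.mem_filter, Fin.lt_def, Fin.ext_iff,
      true_and, true_iff]
    omega
  have h2 : (Finset.univ.filter fun g : Fin (d - 1) => g.val < d - 1) = Finset.univ := by
    ext x; simp
  rw [rightEnd, leftEnd, Fintype.sum_sum_type, h2]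
  conv_rhs => rw [h1, Finset.sum_insert (by simp)]
  ring

/-- The end points of the partition encoded by `s`, enumerated from left to right. -/
noncomputable def endSeq (s : Coord d → ℝ) (m : ℕ) : ℝ :=
  if h : m / 2 < d then (if m % 2 = 0 then leftEnd s ⟨m / 2, h⟩ else rightEnd s ⟨m / 2, h⟩) else 0

theorem endSeq_even (s : Coord d → ℝ) (i : Fin d) : endSeq s (2 * i) = leftEnd s i := by
  have h : 2 * (i : ℕ) / 2 = i := by omega
  simp [endSeq, h]

theorem endSeq_odd (s : Coord d → ℝ) (i : Fin d) : endSeq s (2 * i + 1) = rightEnd s i := by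
  have h : (2 * (i : ℕ) + 1) / 2 = i := by omega
  have h' : (2 * (i : ℕ) + 1) % 2 ≠ 0 := by omega
  simp [endSeq, h]

theorem endSeq_lt_succ {s : Coord d → ℝ} (hs : s ∈ Simp d) {m : ℕ} (hm : m + 1 < 2 * d) :
    endSeq s m < endSeq s (m + 1) := by
  rcases Nat.even_or_odd' m with ⟨i, rfl | rfl⟩
  · have h := endSeq_even s ⟨i, by omega⟩
    have h' := endSeq_odd s ⟨i, by omega⟩
    simp only at h h'
    rw [h, h', rightEnd]
    linarith [(hs.1 (.inl ⟨i, by omega⟩)).1]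
  · have h := endSeq_odd s ⟨i, by omega⟩
    have h' := endSeq_even s ⟨i + 1, by omega⟩
    simp only at h h'
    rw [h, show 2 * i + 1 + 1 = 2 * (i + 1) by ring, h', leftEnd_succ]
    linarith [(hs.1 (.inr ⟨i, by omega⟩)).1]

theorem endSeq_zero (s : Coord d → ℝ) (hd : 0 < d) : endSeq s 0 = 0 := by
  simpa [leftEnd_zero] using endSeq_even s ⟨0, hd⟩

theorem endSeq_one (s : Coord d → ℝ) (hd : 0 < d) : endSeq s 1 = s (.inl ⟨0, hd⟩) := by
  simpa [rightEnd, leftEnd_zero] using endSeq_odd s ⟨0, hd⟩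

theorem endSeq_last (s : Coord d → ℝ) (hd : 0 < d) : endSeq s (2 * d - 1) = ∑ c, s c := by
  have h := endSeq_odd s ⟨d - 1, by omega⟩
  simp only at h
  rw [show 2 * d - 1 = 2 * (d - 1) + 1 by omega, h, rightEnd_last]

theorem endSeq_lt {s : Coord d → ℝ} (hs : s ∈ Simp d) {m n : ℕ} (hmn : m < n) (hn : n < 2 * d) :
    endSeq s m < endSeq s n := by
  induction n, hmn using Nat.le_induction with
  | base => exact endSeq_lt_succ hs hn
  | succ n _ ih => exact (ih (by omega)).trans (endSeq_lt_succ hs hn)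

theorem endSeq_le {s : Coord d → ℝ} (hs : s ∈ Simp d) {m n : ℕ} (hmn : m ≤ n) (hn : n < 2 * d) :
    endSeq s m ≤ endSeq s n := by
  rcases hmn.eq_or_lt with rfl | h
  · rfl
  · exact (endSeq_lt hs h hn).le

theorem endSeq_mem_Icc {s : Coord d → ℝ} (hs : s ∈ Simp d) {m : ℕ} (hm : m < 2 * d) :
    endSeq s m ∈ Icc (0 : ℝ) 1 := by
  refine ⟨?_, ?_⟩
  · rw [← endSeq_zero s (by omega)]
    exact endSeq_le hs m.zero_le hm
  · rw [← hs.2, ← endSeq_last s (by omega)]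
    exact endSeq_le hs (by omega) (by omega)

theorem range_endSeq (s : Coord d → ℝ) :
    range (fun m : Fin (2 * d) => endSeq s m) = endPoints s := by
  apply Subset.antisymm
  · rintro _ ⟨⟨m, hm⟩, rfl⟩
    rcases Nat.even_or_odd' m with ⟨i, rfl | rfl⟩
    · exact Or.inl ⟨⟨i, by omega⟩, (endSeq_even s ⟨i, by omega⟩).symm⟩
    · exact Or.inr ⟨⟨i, by omega⟩, (endSeq_odd s ⟨i, by omega⟩).symm⟩
  · rintro _ (⟨i, rfl⟩ | ⟨i, rfl⟩)
    · exact ⟨⟨2 * i, by omega⟩, endSeq_even s i⟩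
    · exact ⟨⟨2 * i + 1, by omega⟩, endSeq_odd s i⟩

theorem continuous_endSeq (m : ℕ) : Continuous fun s : Coord d → ℝ => endSeq s m := by
  have h : ∀ i : Fin d, Continuous fun s : Coord d → ℝ => leftEnd s i := fun i => by
    unfold leftEnd
    fun_prop
  unfold endSeq
  split_ifs
  · exact h _
  · exact (h _).add (continuous_apply _)
  · exact continuous_const

/-- A map that preserves the order and maps the end points of `s` onto those of `s'` maps them in
the order from left to right. -/
theorem map_endSeq {s s' : Coord d → ℝ} (hs : s ∈ Simp d) (hs' : s' ∈ Simp d) {φ : ℝ → ℝ}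
    (hφ : StrictMonoOn φ (Icc 0 1)) (hm : φ '' endPoints s = endPoints s') {m : ℕ}
    (hm2 : m < 2 * d) : φ (endSeq s m) = endSeq s' m := by
  have h1 : StrictMono fun m : Fin (2 * d) => φ (endSeq s m) := fun i j hij =>
    hφ (endSeq_mem_Icc hs i.2) (endSeq_mem_Icc hs j.2) (endSeq_lt hs hij j.2)
  have h2 : StrictMono fun m : Fin (2 * d) => endSeq s' m := fun i j hij => endSeq_lt hs' hij j.2
  have h3 : range (fun m : Fin (2 * d) => φ (endSeq s m)) =
      range fun m : Fin (2 * d) => endSeq s' m := by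
    rw [range_endSeq, ← hm, ← range_endSeq, ← range_comp]
    rfl
  -- A strictly increasing map on `Fin (2 * d)` is determined by its range.
  exact congrFun ((h1.range_inj h2).1 h3) ⟨m, hm2⟩

end EndPoints

/-! ### Words and compositions of branches -/

section Words

variable {d : ℕ}

/-- The word `j_n … j_1 α` for the list `l = j_1 … j_n`. -/
def revPrepend : List (Fin d) → Word d → Word d
  | [], α => α
  | i :: l, α => revPrepend l (prepend i α)

/-- The composition `G_{j_n} ∘ … ∘ G_{j_1}` for the list `l = j_1 … j_n`. -/
def compL (G : Fin d → ℝ → ℝ) : List (Fin d) → ℝ → ℝ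
  | [], x => x
  | i :: l, x => compL G l (G i x)

theorem compL_append (G : Fin d → ℝ → ℝ) (l l' : List (Fin d)) (x : ℝ) :
    compL G (l ++ l') x = compL G l' (compL G l x) := by
  induction l generalizing x with
  | nil => rfl
  | cons i l ih => exact ih _

theorem compL_replicate (G : Fin d → ℝ → ℝ) (i : Fin d) (n : ℕ) (x : ℝ) :
    compL G (List.replicate n i) x = (G i)^[n] x := by
  induction n generalizing x with
  | zero => rfl
  | succ n ih => rw [List.replicate_succ, compL, ih, Function.iterate_succ_apply]

theorem initial_succ (j : Word d) (n : ℕ) : initial j (n + 1) = initial j n ++ [j n] := by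
  simp [initial, List.range_succ]

theorem prepend_shift (α : Word d) : prepend (α 0) (shift α) = α := by
  ext n
  cases n <;> rfl

theorem shift_prepend (i : Fin d) (α : Word d) : shift (prepend i α) = α := rfl

theorem revPrepend_apply_add (l : List (Fin d)) (α : Word d) (m : ℕ) :
    revPrepend l α (l.length + m) = α m := by
  induction l generalizing α m with
  | nil => simp [revPrepend]
  | cons i l ih =>
    rw [revPrepend, List.length_cons, show l.length + 1 + m = l.length + (m + 1) by ring, ih]
    rfl

theorem initial_revPrepend (l : List (Fin d)) (α : Word d) :
    initial (revPrepend l α) l.length = l.reverse := by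
  induction l generalizing α with
  | nil => simp [initial]
  | cons i l ih =>
    rw [List.length_cons, initial_succ, List.reverse_cons, revPrepend, ih]
    have := revPrepend_apply_add l (prepend i α) 0
    rw [add_zero] at this
    rw [this]
    rfl

/-- This makes each piece the image of the whole Cantor set under a composition of branches. -/
theorem range_revPrepend (l : List (Fin d)) :
    range (revPrepend l) = {β | initial β l.length = l.reverse} := by
  apply Subset.antisymm
  · rintro _ ⟨α, rfl⟩
    exact initial_revPrepend l α
  · intro β hβ
    refine ⟨fun m => β (l.length + m), ?_⟩
    ext1 m
    rcases lt_or_ge m l.length with h | h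
    · have h1 := (initial_revPrepend l fun m => β (l.length + m)).trans (Eq.symm hβ)
      exact List.map_inj_left.1 h1 m (List.mem_range.2 h)
    · obtain ⟨m, rfl⟩ := Nat.exists_eq_add_of_le h
      exact revPrepend_apply_add _ _ _

end Words

/-! ### Embeddings coded by a system of branches -/

section Coding

variable {d : ℕ}

/-- The embedding `h` conjugates the right-inverses of the shift to the increasing maps `G i`. -/
structure IsCodedBy (h : Word d → ℝ) (G : Fin d → ℝ → ℝ) : Prop where
  embedding : IsCantorEmbedding h
  strictMono : ∀ i, StrictMono (G i)
  map_eq : ∀ i α, G i (h α) = h (prepend i α)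

variable {h : Word d → ℝ} {G : Fin d → ℝ → ℝ}

theorem IsCantorEmbedding.le_of_forall_le (hh : IsCantorEmbedding h) {α β : Word d}
    (hαβ : ∀ n, α n ≤ β n) : h α ≤ h β := by
  by_contra hlt
  obtain ⟨m, -, hm⟩ := (hh.lt_iff α β).1 (not_le.1 hlt)
  exact absurd (hαβ m) (not_le.2 hm)

theorem IsCantorEmbedding.mem_Icc (hh : IsCantorEmbedding h) (α : Word d) :
    h α ∈ Icc (0 : ℝ) 1 := hh.hull ▸ subset_convexHull ℝ _ ⟨α, rfl⟩

/-- The constant words in the least and the greatest letter are the extremes of the lexicographic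
order, so the hull [0,1] lies between their images. -/
theorem IsCantorEmbedding.eq_zero_and_eq_one (hh : IsCantorEmbedding h) (hd : 0 < d) :
    h (fun _ => ⟨0, hd⟩) = 0 ∧ h (fun _ => ⟨d - 1, by omega⟩) = 1 := by
  have hsub : Icc (0 : ℝ) 1 ⊆ Icc (h fun _ => ⟨0, hd⟩) (h fun _ => ⟨d - 1, by omega⟩) := by
    rw [← hh.hull]
    refine convexHull_min ?_ (convex_Icc _ _)
    rintro _ ⟨α, rfl⟩
    exact ⟨hh.le_of_forall_le fun n => Fin.le_def.2 (Nat.zero_le _),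
      hh.le_of_forall_le fun n => Fin.le_def.2 (Nat.le_sub_one_of_lt (α n).2)⟩
  have h1 := hsub (left_mem_Icc.2 zero_le_one)
  have h2 := hsub (right_mem_Icc.2 zero_le_one)
  exact ⟨le_antisymm h1.1 (hh.mem_Icc _).1, le_antisymm (hh.mem_Icc _).2 h2.2⟩

theorem IsCodedBy.strictMono_compL (hh : IsCodedBy h G) (l : List (Fin d)) :
    StrictMono (compL G l) := by
  induction l with
  | nil => exact strictMono_id
  | cons i l ih => exact ih.comp (hh.strictMono i)

theorem IsCodedBy.compL_apply (hh : IsCodedBy h G) (l : List (Fin d)) (α : Word d) :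
    compL G l (h α) = h (revPrepend l α) := by
  induction l generalizing α with
  | nil => rfl
  | cons i l ih => rw [compL, hh.map_eq, ih, revPrepend]

theorem IsCodedBy.piece_eq (hh : IsCodedBy h G) (l : List (Fin d)) :
    piece h l = compL G l '' range h := by
  rw [piece, ← range_revPrepend, ← range_comp, ← range_comp]
  congr 1
  ext α
  exact (hh.compL_apply l α).symm

theorem IsCodedBy.sInf_piece (hh : IsCodedBy h G) (hd : 0 < d) (l : List (Fin d)) :
    sInf (piece h l) = compL G l 0 := by
  rw [hh.piece_eq]
  refine IsLeast.csInf_eq ⟨⟨0, ⟨_, (hh.embedding.eq_zero_and_eq_one hd).1⟩, rfl⟩, ?_⟩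
  rintro _ ⟨_, ⟨α, rfl⟩, rfl⟩
  exact (hh.strictMono_compL l).monotone (hh.embedding.mem_Icc α).1

theorem IsCodedBy.sSup_piece (hh : IsCodedBy h G) (hd : 0 < d) (l : List (Fin d)) :
    sSup (piece h l) = compL G l 1 := by
  rw [hh.piece_eq]
  refine IsGreatest.csSup_eq ⟨⟨1, ⟨_, (hh.embedding.eq_zero_and_eq_one hd).2⟩, rfl⟩, ?_⟩
  rintro _ ⟨_, ⟨α, rfl⟩, rfl⟩
  exact (hh.strictMono_compL l).monotone (hh.embedding.mem_Icc α).2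

/-- The ratio `|c[x,y]| / |c[0,1]|` of distances in the image of `c`. -/
noncomputable def relRatio (c : ℝ → ℝ) (x y : ℝ) : ℝ := (c y - c x) / (c 1 - c 0)

/-- The letter put in front of `l` acts innermost in `compL`, so a ratio geometry is the first-level
partition seen through `compL G l`. -/
theorem IsCodedBy.ratioGeometry_inl (hh : IsCodedBy h G) (l : List (Fin d)) (i : Fin d) :
    ratioGeometry h l (.inl i) = relRatio (compL G l) (G i 0) (G i 1) := by
  have hd : 0 < d := i.pos
  simp only [ratioGeometry, hullLength, hh.sInf_piece hd, hh.sSup_piece hd]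
  rfl

theorem IsCodedBy.ratioGeometry_inr (hh : IsCodedBy h G) (l : List (Fin d)) (g : Fin (d - 1)) :
    ratioGeometry h l (.inr g) =
      relRatio (compL G l) (G ⟨g, by omega⟩ 1) (G ⟨g + 1, by omega⟩ 0) := by
  have hd : 0 < d := g.pos.trans_le (Nat.sub_le _ _)
  simp only [ratioGeometry, hullLength, hh.sInf_piece hd, hh.sSup_piece hd]
  rfl

theorem IsCodedBy.first_zero (hh : IsCodedBy h G) (hd : 0 < d) : G ⟨0, hd⟩ 0 = 0 := by
  have h1 := (hh.embedding.eq_zero_and_eq_one hd).1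
  have h2 := hh.map_eq ⟨0, hd⟩ (fun _ => ⟨0, hd⟩)
  rw [h1, show prepend ⟨0, hd⟩ (fun _ => ⟨0, hd⟩) = fun _ => (⟨0, hd⟩ : Fin d) by
    ext n; cases n <;> rfl, h1] at h2
  exact h2

theorem IsCodedBy.last_one (hh : IsCodedBy h G) (hd : 0 < d) : G ⟨d - 1, by omega⟩ 1 = 1 := by
  have h1 := (hh.embedding.eq_zero_and_eq_one hd).2
  have h2 := hh.map_eq ⟨d - 1, by omega⟩ (fun _ => ⟨d - 1, by omega⟩)
  rw [h1, show prepend ⟨d - 1, by omega⟩ (fun _ => ⟨d - 1, by omega⟩) =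
    fun _ => (⟨d - 1, by omega⟩ : Fin d) by ext n; cases n <;> rfl, h1] at h2
  exact h2

theorem IsCodedBy.lt_next (hh : IsCodedBy h G) {i j : Fin d} (hij : i < j) : G i 1 < G j 0 := by
  have hd : 0 < d := i.pos
  obtain ⟨h0, h1⟩ := hh.embedding.eq_zero_and_eq_one hd
  rw [← h0, ← h1, hh.map_eq, hh.map_eq, hh.embedding.lt_iff]
  exact ⟨0, by simp, hij⟩

theorem IsCodedBy.map_mem_Icc (hh : IsCodedBy h G) (i : Fin d) {x : ℝ} (hx : x ∈ Icc (0 : ℝ) 1) :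
    G i x ∈ Icc (0 : ℝ) 1 := by
  have hd := i.pos
  obtain ⟨h0, h1⟩ := hh.embedding.eq_zero_and_eq_one hd
  have e0 := (hh.embedding.mem_Icc (prepend i fun _ => ⟨0, hd⟩)).1
  have e1 := (hh.embedding.mem_Icc (prepend i fun _ => ⟨d - 1, by omega⟩)).2
  rw [← hh.map_eq, h0] at e0
  rw [← hh.map_eq, h1] at e1
  exact ⟨e0.trans ((hh.strictMono i).monotone hx.1), ((hh.strictMono i).monotone hx.2).trans e1⟩

theorem IsCodedBy.compL_mem_Icc (hh : IsCodedBy h G) (l : List (Fin d)) {x : ℝ}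
    (hx : x ∈ Icc (0 : ℝ) 1) : compL G l x ∈ Icc (0 : ℝ) 1 := by
  induction l generalizing x with
  | nil => exact hx
  | cons i l ih => exact ih (hh.map_mem_Icc i hx)

/-- The end points of the intervals `G i [0,1]`, enumerated from left to right. -/
noncomputable def branchSeq (G : Fin d → ℝ → ℝ) (m : ℕ) : ℝ :=
  if h : m / 2 < d then G ⟨m / 2, h⟩ ((m % 2 : ℕ) : ℝ) else 0

theorem IsCodedBy.branchSeq_mem_Icc (hh : IsCodedBy h G) (m : ℕ) :
    branchSeq G m ∈ Icc (0 : ℝ) 1 := by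
  unfold branchSeq
  split_ifs
  · refine hh.map_mem_Icc _ ⟨by positivity, ?_⟩
    exact_mod_cast Nat.le_of_lt_succ (Nat.mod_lt m two_pos)
  · simp

theorem IsCodedBy.leftEnd_ratioGeometry (hh : IsCodedBy h G) (l : List (Fin d)) (i : ℕ)
    (hi : i < d) : leftEnd (ratioGeometry h l) ⟨i, hi⟩ = relRatio (compL G l) 0 (G ⟨i, hi⟩ 0) := by
  induction i with
  | zero => rw [leftEnd_zero, hh.first_zero, relRatio, sub_self, zero_div]
  | succ i ih =>
    rw [leftEnd_succ, rightEnd, ih, hh.ratioGeometry_inl, hh.ratioGeometry_inr]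
    simp only [relRatio]
    ring

theorem IsCodedBy.endSeq_ratioGeometry (hh : IsCodedBy h G) (l : List (Fin d)) {m : ℕ}
    (hm : m < 2 * d) :
    endSeq (ratioGeometry h l) m = relRatio (compL G l) 0 (branchSeq G m) := by
  have hm' : m / 2 < d := by omega
  rw [endSeq, branchSeq, dif_pos hm', dif_pos hm']
  split_ifs with h0
  · rw [hh.leftEnd_ratioGeometry, h0, Nat.cast_zero]
  · rw [rightEnd, hh.leftEnd_ratioGeometry, hh.ratioGeometry_inl,
      show m % 2 = 1 by omega, Nat.cast_one]
    simp only [relRatio]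
    ring

theorem branchSeq_one (G : Fin d → ℝ → ℝ) (hd : 0 < d) :
    branchSeq G 1 = G ⟨0, hd⟩ 1 := by simp [branchSeq, hd]

theorem IsCodedBy.branchSeq_last (hh : IsCodedBy h G) (hd : 0 < d) :
    branchSeq G (2 * d - 1) = 1 := by
  have h1 : (2 * d - 1) / 2 = d - 1 := by omega
  have h2 : (2 * d - 1) % 2 = 1 := by omega
  simp [branchSeq, hd, h1, h2, hh.last_one hd]

theorem IsCodedBy.relRatio_zero_one (hh : IsCodedBy h G) (l : List (Fin d)) :
    relRatio (compL G l) 0 1 = 1 :=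
  div_self (sub_pos.2 (hh.strictMono_compL l one_pos)).ne'

theorem IsCodedBy.sum_ratioGeometry (hh : IsCodedBy h G) (hd : 0 < d) (l : List (Fin d)) :
    ∑ c, ratioGeometry h l c = 1 := by
  rw [← endSeq_last _ hd, hh.endSeq_ratioGeometry l (by omega), hh.branchSeq_last hd,
    hh.relRatio_zero_one]

/-- The end points given by the scaling function are limits of relative positions. -/
theorem IsCodedBy.tendsto_endSeq (hh : IsCodedBy h G) {S : Word d → Coord d → ℝ}
    (hS : IsScalingFunction h S) (j : Word d) {m : ℕ} (hm : m < 2 * d) :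
    Tendsto (fun n => relRatio (compL G (initial j n)) 0 (branchSeq G m)) atTop
      (𝓝 (endSeq (S j) m)) :=
  (((continuous_endSeq m).tendsto (S j)).comp (hS.2 j)).congr fun _ =>
    hh.endSeq_ratioGeometry _ hm

end Coding

/-! ### Bounded distortion and the existence of the scaling function -/

section Scaling

variable {d : ℕ} {h : Word d → ℝ} {G : Fin d → ℝ → ℝ} {a K : ℝ}

theorem abs_compL_sub_le (hK : 0 ≤ K)
    (hG : ∀ i, ∀ x y, |G i x - G i y| ≤ K * |x - y|) (l : List (Fin d)) (x y : ℝ) :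
    |compL G l x - compL G l y| ≤ K ^ l.length * |x - y| := by
  induction l generalizing x y with
  | nil => simp [compL]
  | cons i l ih =>
    rw [compL, compL, List.length_cons, pow_succ, mul_assoc]
    exact (ih _ _).trans (by gcongr; exact hG i x y)

theorem relRatio_pos {c : ℝ → ℝ} (hc : StrictMono c) {x y : ℝ} (hxy : x < y) :
    0 < relRatio c x y :=
  div_pos (sub_pos.2 (hc hxy)) (sub_pos.2 (hc one_pos))

/-- Bounded distortion: relative distances converge along every infinite word, and their limits are
comparable to the distances. -/
theorem IsCodedBy.exists_relRatio_limit (hh : IsCodedBy h G) (ha : 0 < a) (ha1 : a ≤ 1)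
    (hG : ∀ i, HolderClass a 1 (G i)) (hK0 : 0 ≤ K) (hK1 : K < 1)
    (hpos : ∀ i x, 0 < deriv (G i) x) (hGK : ∀ i x, deriv (G i) x ≤ K) :
    ∃ (C : ℝ) (R : Word d → ℝ → ℝ → ℝ), ∀ j, ∀ x ∈ Icc (0 : ℝ) 1, ∀ y ∈ Icc (0 : ℝ) 1, x < y →
      Tendsto (fun n => relRatio (compL G (initial j n)) x y) atTop (𝓝 (R j x y)) ∧
      Real.exp (-C) * (y - x) ≤ R j x y ∧ R j x y ≤ Real.exp C * (y - x) := by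
  have hlog : ∀ i, ∃ C : ℝ, 0 ≤ C ∧ ∀ x ∈ Icc (-1 : ℝ) 1, ∀ y ∈ Icc (-1 : ℝ) 1,
      |Real.log (deriv (G i) x) - Real.log (deriv (G i) y)| ≤ C * |x - y| ^ a := fun i =>
    LocHolder.exists_bound (HolderClass.log (n := 0) ha ha1 (hG i).2 (hpos i)) 1
  choose B hB0 hB using hlog
  set b := ∑ i, B i with hb
  have hBb : ∀ i, B i ≤ b := fun i =>
    Finset.single_le_sum (f := B) (fun i _ => hB0 i) (Finset.mem_univ i)
  have hlip : ∀ i, ∀ x y, |G i x - G i y| ≤ K * |x - y| := fun i =>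
    lipschitz_of_deriv_le (hG i).1 (hpos i) (hGK i)
  have hq : K ^ a < 1 := Real.rpow_lt_one hK0 hK1 ha
  -- One more letter multiplies the ratio by G'(t)/G'(u) with t, u in an interval of length at most
  -- K^n; Hölder continuity of log G' makes the change of the logarithm geometrically small.
  have step : ∀ (j : Word d) (x y : ℝ), x ∈ Icc (0 : ℝ) 1 → y ∈ Icc (0 : ℝ) 1 → x < y → ∀ n,
      dist (Real.log (relRatio (compL G (initial j n)) x y))
        (Real.log (relRatio (compL G (initial j (n + 1))) x y)) ≤ b * (K ^ a) ^ n := by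
    intro j x y hx hy hxy n
    set l := initial j n with hl
    have hln : l.length = n := by simp [hl, initial]
    have hsm := hh.strictMono_compL l
    have hmvt : ∀ u v : ℝ, u ∈ Icc (0 : ℝ) 1 → v ∈ Icc (0 : ℝ) 1 → u < v →
        ∃ t ∈ Icc (compL G l 0) (compL G l 1),
          G (j n) (compL G l v) - G (j n) (compL G l u) =
            deriv (G (j n)) t * (compL G l v - compL G l u) := by
      intro u v hu hv huv
      obtain ⟨t, ht, ht'⟩ := exists_deriv_eq_slope (G (j n)) (hsm huv)
        (hG (j n)).1.continuous.continuousOn (hG (j n)).1.differentiableOn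
      refine ⟨t, ⟨(hsm.monotone hu.1).trans ht.1.le, ht.2.le.trans (hsm.monotone hv.2)⟩, ?_⟩
      rw [ht', div_mul_cancel₀ _ (sub_pos.2 (hsm huv)).ne']
    obtain ⟨t, ht, ht'⟩ := hmvt x y hx hy hxy
    obtain ⟨u, hu, hu'⟩ := hmvt 0 1 (by simp) (by simp) one_pos
    have hrel : relRatio (compL G (initial j (n + 1))) x y =
        deriv (G (j n)) t / deriv (G (j n)) u * relRatio (compL G l) x y := by
      simp only [relRatio, initial_succ, ← hl, compL_append, compL]
      rw [ht', hu', mul_div_mul_comm]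
    rw [hrel, Real.log_mul (div_pos (hpos _ _) (hpos _ _)).ne' (relRatio_pos hsm hxy).ne',
      Real.log_div (hpos _ _).ne' (hpos _ _).ne', Real.dist_eq]
    have hsub : Icc (compL G l 0) (compL G l 1) ⊆ Icc (-1 : ℝ) 1 := fun s hs =>
      ⟨by linarith [(hh.compL_mem_Icc l (x := 0) (by simp)).1, hs.1],
        hs.2.trans (hh.compL_mem_Icc l (x := 1) (by simp)).2⟩
    have hlen : |t - u| ≤ K ^ n := by
      have h1 := abs_compL_sub_le hK0 hlip l 1 0
      rw [hln] at h1
      have h2 := le_abs_self (compL G l 1 - compL G l 0)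
      have h3 : |t - u| ≤ compL G l 1 - compL G l 0 :=
        abs_le.2 ⟨by linarith [ht.1, hu.2], by linarith [ht.2, hu.1]⟩
      simp only [sub_zero, abs_one, mul_one] at h1
      linarith
    rw [show ∀ p q r : ℝ, p - (q - r + p) = -(q - r) by intros; ring, abs_neg]
    calc _ ≤ B (j n) * |t - u| ^ a := hB _ t (hsub ht) u (hsub hu)
      _ ≤ b * (K ^ n) ^ a := by
        gcongr
        · exact Finset.sum_nonneg fun i _ => hB0 i
        · exact hBb _
      _ = _ := by
        rw [← Real.rpow_natCast, ← Real.rpow_natCast, ← Real.rpow_mul hK0, ← Real.rpow_mul hK0,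
          mul_comm (n : ℝ) a]
  have hex : ∀ (j : Word d) (x y : ℝ), ∃ R, x ∈ Icc (0 : ℝ) 1 → y ∈ Icc (0 : ℝ) 1 → x < y →
      Tendsto (fun n => Real.log (relRatio (compL G (initial j n)) x y)) atTop (𝓝 R) := by
    intro j x y
    by_cases hc : x ∈ Icc (0 : ℝ) 1 ∧ y ∈ Icc (0 : ℝ) 1 ∧ x < y
    · obtain ⟨R, hR⟩ := cauchySeq_tendsto_of_complete
        (cauchySeq_of_le_geometric _ _ hq (step j x y hc.1 hc.2.1 hc.2.2))
      exact ⟨R, fun _ _ _ => hR⟩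
    · exact ⟨0, fun h1 h2 h3 => absurd ⟨h1, h2, h3⟩ hc⟩
  choose L hL using hex
  -- The constant is the sum of the geometric errors, starting from n = 0, where the ratio is y - x
  -- itself.
  refine ⟨b / (1 - K ^ a), fun j x y => Real.exp (L j x y), fun j x hx y hy hxy => ?_⟩
  have hlim := hL j x y hx hy hxy
  have hdist := dist_le_of_le_geometric_of_tendsto₀ _ _ hq (step j x y hx hy hxy) hlim
  have h0 : relRatio (compL G (initial j 0)) x y = y - x := by
    simp [relRatio, initial, compL]
  rw [h0, Real.dist_eq, abs_le] at hdist
  have hxy' : 0 < y - x := sub_pos.2 hxy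
  refine ⟨((Real.continuous_exp.tendsto _).comp hlim).congr fun n =>
    Real.exp_log (relRatio_pos (hh.strictMono_compL _) hxy), ?_, ?_⟩
  · conv_lhs => rw [← Real.exp_log hxy', ← Real.exp_add]
    exact Real.exp_le_exp.2 (by linarith [hdist.2])
  · conv_rhs => rw [← Real.exp_log hxy', ← Real.exp_add]
    exact Real.exp_le_exp.2 (by linarith [hdist.1])

theorem initial_splice (j w : Word d) (n N : ℕ) :
    initial (splice j n w) (n + N) = initial j n ++ initial w N := by
  induction N with
  | zero =>
    simp only [initial, List.range_zero, List.map_nil, List.append_nil, add_zero]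
    refine List.map_congr_left fun m hm => ?_
    simp [splice, List.mem_range.1 hm]
  | succ N ih =>
    rw [← add_assoc, initial_succ, ih, initial_succ, List.append_assoc]
    simp [splice]

theorem initial_const (i : Fin d) (n : ℕ) : initial (fun _ => i) n = List.replicate n i := by
  simp [initial, List.map_const']

theorem iterate_shift_apply (t : ℕ) (α : Word d) (m : ℕ) : shift^[t] α m = α (m + t) := by
  induction t generalizing m with
  | zero => rfl
  | succ t ih =>
    rw [Function.iterate_succ_apply', shift, ih]
    congr 1
    ring

theorem relRatio_comp_iterate (G : Fin d → ℝ → ℝ) (z : Fin d) (n : ℕ) (l : List (Fin d))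
    (x y : ℝ) : relRatio (compL G (List.replicate n z ++ l)) x y =
      (compL G l ((G z)^[n] y) - compL G l ((G z)^[n] x)) /
        (compL G l ((G z)^[n] 1) - compL G l ((G z)^[n] 0)) := by
  simp only [relRatio, compL_append, compL_replicate]

/-- The scaling function exists, and it is bounded below and satisfies the estimate for `rho`
expected from bounded distortion. -/
theorem IsCodedBy.exists_scalingFunction (hh : IsCodedBy h G) (ha : 0 < a) (ha1 : a ≤ 1)
    (hd : 1 < d) (hG : ∀ i, HolderClass a 1 (G i)) (hK0 : 0 ≤ K) (hK1 : K < 1)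
    (hpos : ∀ i x, 0 < deriv (G i) x) (hGK : ∀ i x, deriv (G i) x ≤ K) :
    ∃ S : Word d → Coord d → ℝ, IsScalingFunction h S ∧
      (∃ c > 0, ∀ j, c ≤ S j (.inl ⟨0, by omega⟩)) ∧
      ∃ C > 0, ∀ (n : ℕ) (j j' : Word d), j ≠ j' → PiNat.firstDiff j j' = n →
        (∀ t < n, j t = ⟨0, by omega⟩) → rho S j j' ≤ C * (G ⟨0, by omega⟩)^[n] 1 := by
  obtain ⟨C, R, hR⟩ := hh.exists_relRatio_limit ha ha1 hG hK0 hK1 hpos hGK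
  have hd0 : 0 < d := by omega
  set z : Fin d := ⟨0, hd0⟩ with hz
  have h01 : ∀ i : Fin d, G i 0 < G i 1 := fun i => hh.strictMono i one_pos
  have hI0 : (0 : ℝ) ∈ Icc (0 : ℝ) 1 := by simp
  have hI1 : (1 : ℝ) ∈ Icc (0 : ℝ) 1 := by simp
  let S : Word d → Coord d → ℝ := fun j c => match c with
    | .inl i => R j (G i 0) (G i 1)
    | .inr g => R j (G ⟨g, by omega⟩ 1) (G ⟨g + 1, by omega⟩ 0)
  have hlim : ∀ j, Tendsto (fun n => ratioGeometry h (initial j n)) atTop (𝓝 (S j)) := by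
    intro j
    refine tendsto_pi_nhds.2 fun c => ?_
    rcases c with i | g
    · simp only [hh.ratioGeometry_inl]
      exact (hR j _ (hh.map_mem_Icc i hI0) _ (hh.map_mem_Icc i hI1) (h01 i)).1
    · simp only [hh.ratioGeometry_inr]
      exact (hR j _ (hh.map_mem_Icc _ hI1) _ (hh.map_mem_Icc _ hI0)
        (hh.lt_next (Fin.lt_def.2 (Nat.lt_succ_self _)))).1
  have hRpos : ∀ j, ∀ x ∈ Icc (0 : ℝ) 1, ∀ y ∈ Icc (0 : ℝ) 1, x < y → 0 < R j x y :=
    fun j x hx y hy hxy =>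
      (mul_pos (Real.exp_pos _) (sub_pos.2 hxy)).trans_le (hR j x hx y hy hxy).2.1
  have hSpos : ∀ j c, 0 < S j c := by
    rintro j (i | g)
    · exact hRpos j _ (hh.map_mem_Icc i hI0) _ (hh.map_mem_Icc i hI1) (h01 i)
    · exact hRpos j _ (hh.map_mem_Icc _ hI1) _ (hh.map_mem_Icc _ hI0)
        (hh.lt_next (Fin.lt_def.2 (Nat.lt_succ_self _)))
  have hSsum : ∀ j, ∑ c, S j c = 1 := by
    intro j
    refine tendsto_nhds_unique (tendsto_finsetSum _ fun c _ => (tendsto_pi_nhds.1 (hlim j)) c)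
      (tendsto_const_nhds.congr fun n => (hh.sum_ratioGeometry hd0 _).symm)
  have hSlt : ∀ j c, S j c < 1 := by
    intro j c
    -- As d ≥ 2 there is a second positive coordinate, so no single one exhausts the sum 1.
    obtain ⟨c', hc'⟩ : ∃ c' : Coord d, c' ≠ c := by
      rcases c with i | g
      · exact ⟨.inr ⟨0, by omega⟩, by simp⟩
      · exact ⟨.inl z, by simp⟩
    rw [← hSsum j]
    exact Finset.single_lt_sum hc' (Finset.mem_univ _) (Finset.mem_univ _) (hSpos j c')
      fun c _ _ => (hSpos j c).le
  have hS : IsScalingFunction h S := ⟨fun j => ⟨fun c => ⟨hSpos j c, hSlt j c⟩, hSsum j⟩, hlim⟩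
  refine ⟨S, hS, ⟨Real.exp (-C) * (G z 1 - G z 0), mul_pos (Real.exp_pos _) (sub_pos.2 (h01 z)),
    fun j => (hR j _ (hh.map_mem_Icc z hI0) _ (hh.map_mem_Icc z hI1) (h01 z)).2.1⟩,
    Real.exp C, Real.exp_pos _, fun n j j' hjj' hn hj => ?_⟩
  have hTmem : ∀ m, (G z)^[m] 1 ∈ Icc (0 : ℝ) 1 := by
    intro m
    induction m with
    | zero => exact hI1
    | succ m ih => rw [Function.iterate_succ_apply']; exact hh.map_mem_Icc z ih
  have hT0 : ∀ m, (G z)^[m] 0 = 0 := fun m => Function.iterate_fixed (hh.first_zero hd0) m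
  have hTpos : ∀ m, 0 < (G z)^[m] 1 := fun m => by
    rw [← hT0 m]; exact (hh.strictMono z).iterate m one_pos
  -- With T = `G z`, the first coordinate of S at z^m w is a quotient of limiting relative lengths
  -- of T^{m+1}[0,1] and T^m[0,1]. The product in `rho` therefore telescopes to `R w 0 (T^n 1)`,
  -- which distortion bounds uniformly in w.
  have hSz : ∀ (w : Word d) (m : ℕ), S (splice (fun _ => z) m w) (.inl z) =
      R w 0 ((G z)^[m + 1] 1) / R w 0 ((G z)^[m] 1) := by
    intro w m
    have h1 := (tendsto_pi_nhds.1 (hlim (splice (fun _ => z) m w))) (.inl z)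
    have h2 := ((hR w 0 hI0 _ (hTmem (m + 1)) (hTpos _)).1).div
      ((hR w 0 hI0 _ (hTmem m) (hTpos _)).1) (hRpos w 0 hI0 _ (hTmem m) (hTpos _)).ne'
    refine tendsto_nhds_unique (h1.comp (tendsto_add_atTop_nat m)) (h2.congr fun N => ?_)
    have h3 : 0 < compL G (initial w N) 1 - compL G (initial w N) 0 :=
      sub_pos.2 (hh.strictMono_compL _ one_pos)
    simp only [Function.comp, Pi.div_apply]
    rw [add_comm N m, hh.ratioGeometry_inl, initial_splice, initial_const, relRatio_comp_iterate,
      relRatio, relRatio, div_div_div_cancel_right₀ h3.ne', hT0, ← Function.iterate_succ_apply,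
      ← Function.iterate_succ_apply, hT0]
  have hrho : rho S j j' = ⨆ w : Word d, ∏ t ∈ Finset.range n,
      S (shift^[t + 1] (splice j n w)) (.inl (j t)) := by
    rw [rho, if_neg hjj', hn]
  rw [hrho]
  have : Nonempty (Word d) := ⟨j⟩
  refine ciSup_le fun w => ?_
  have hprod : ∏ t ∈ Finset.range n, S (shift^[t + 1] (splice j n w)) (.inl (j t)) =
      ∏ t ∈ Finset.range n, R w 0 ((G z)^[n - 1 - t + 1] 1) / R w 0 ((G z)^[n - 1 - t] 1) := by
    refine Finset.prod_congr rfl fun t ht => ?_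
    have ht' := Finset.mem_range.1 ht
    have hw : shift^[t + 1] (splice j n w) = splice (fun _ => z) (n - 1 - t) w := by
      ext1 m
      rw [iterate_shift_apply]
      simp only [splice]
      by_cases hm : m < n - 1 - t
      · rw [if_pos hm, if_pos (by omega), hj _ (by omega)]
      · rw [if_neg hm, if_neg (by omega)]
        congr 1
        omega
    rw [hj t ht', ← hSz w, hw]
  have hR1 : R w 0 1 = 1 :=
    tendsto_nhds_unique (hR w 0 hI0 1 hI1 one_pos).1
      (tendsto_const_nhds.congr fun n => (hh.relRatio_zero_one _).symm)
  have htel : ∀ N, ∏ t ∈ Finset.range N, R w 0 ((G z)^[t + 1] 1) / R w 0 ((G z)^[t] 1) =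
      R w 0 ((G z)^[N] 1) := by
    intro N
    induction N with
    | zero => simpa using hR1.symm
    | succ N ih =>
      rw [Finset.prod_range_succ, ih, mul_div_cancel₀ _ (hRpos w 0 hI0 _ (hTmem N) (hTpos N)).ne']
  rw [hprod, Finset.prod_range_reflect
    (fun t => R w 0 ((G z)^[t + 1] 1) / R w 0 ((G z)^[t] 1)) n, htel]
  simpa using (hR w 0 hI0 _ (hTmem n) (hTpos n)).2.2

end Scaling

/-! ### The Cantor set of a system of contractions -/

section Attractor

variable {d : ℕ} {G : Fin d → ℝ → ℝ} {K : ℝ}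

theorem continuous_shift : Continuous (shift (d := d)) :=
  continuous_pi fun n => continuous_apply (n + 1)

/-- The coding is the fixed point of u ↦ (α ↦ `G (α 0) (u (shift α))`), a K-contraction of the
continuous functions on the compact word space. -/
theorem exists_continuous_coding (hK0 : 0 ≤ K) (hK1 : K < 1)
    (hG : ∀ i x y, |G i x - G i y| ≤ K * |x - y|) :
    ∃ h : Word d → ℝ, Continuous h ∧ ∀ α, h α = G (α 0) (h (shift α)) := by
  have hGc : ∀ i, Continuous (G i) := fun i =>
    (LipschitzWith.of_dist_le_mul (K := ⟨K, hK0⟩) (hG i)).continuous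
  have hGu : Continuous fun p : Fin d × ℝ => G p.1 p.2 :=
    continuous_prod_of_discrete_left.2 hGc
  let F : C(Word d, ℝ) → C(Word d, ℝ) := fun u =>
    ⟨fun α => G (α 0) (u (shift α)),
      hGu.comp ((continuous_apply 0).prodMk (u.continuous.comp continuous_shift))⟩
  have hF : ContractingWith ⟨K, hK0⟩ F := by
    refine ⟨by exact_mod_cast hK1, LipschitzWith.of_dist_le_mul fun u v => ?_⟩
    refine (ContinuousMap.dist_le (by positivity)).2 fun α => (hG _ _ _).trans ?_
    exact mul_le_mul_of_nonneg_left
      (ContinuousMap.dist_apply_le_dist (f := u) (g := v) (shift α)) hK0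
  have hfix := hF.fixedPoint_isFixedPt
  exact ⟨_, (hF.fixedPoint F).continuous, fun α =>
    (congrArg (fun u : C(Word d, ℝ) => u α) hfix).symm⟩

/-- A system of increasing contractions with disjoint, ordered images of the unit interval codes an
embedding of the symbol space. -/
theorem exists_isCodedBy (hd : 0 < d) (hK0 : 0 ≤ K) (hK1 : K < 1)
    (hG : ∀ i x y, |G i x - G i y| ≤ K * |x - y|) (hmono : ∀ i, StrictMono (G i))
    (h0 : G ⟨0, hd⟩ 0 = 0) (h1 : G ⟨d - 1, Nat.sub_lt hd one_pos⟩ 1 = 1)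
    (hlt : ∀ i j, i < j → G i 1 < G j 0) : ∃ h, IsCodedBy h G := by
  obtain ⟨h, hc, heq⟩ := exists_continuous_coding hK0 hK1 hG
  have hG0 : ∀ i, 0 ≤ G i 0 := fun i => by
    rcases Nat.eq_zero_or_pos i.val with hi | hi
    · rw [show i = ⟨0, hd⟩ from Fin.ext hi, h0]
    · have := hlt ⟨0, hd⟩ i (Fin.lt_def.2 hi)
      have h2 := hmono ⟨0, hd⟩ one_pos
      linarith
  have hG1 : ∀ i, G i 1 ≤ 1 := fun i => by
    rcases (Nat.le_sub_one_of_lt i.2).eq_or_lt with hi | hi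
    · rw [show i = ⟨d - 1, Nat.sub_lt hd one_pos⟩ from Fin.ext hi, h1]
    · have := hlt i ⟨d - 1, Nat.sub_lt hd one_pos⟩ (Fin.lt_def.2 hi)
      have h2 := hmono ⟨d - 1, Nat.sub_lt hd one_pos⟩ one_pos
      linarith
  have hne : (univ : Set (Word d)).Nonempty := ⟨fun _ => ⟨0, hd⟩, mem_univ _⟩
  -- The branches act on the whole line, so that h has values in [0,1] needs proof. At a minimum m <
  -- 0 of h a branch would satisfy G(m) ≤ m, while G(0) ≥ 0 and contraction give G(m) ≥ Km > m. The
  -- upper bound is symmetric.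
  have hge : ∀ α, 0 ≤ h α := by
    obtain ⟨α, -, hα⟩ := isCompact_univ.exists_isMinOn hne hc.continuousOn
    suffices 0 ≤ h α from fun β => this.trans (hα (mem_univ β))
    by_contra hneg
    push Not at hneg
    have e1 : G (α 0) (h α) ≤ h α := by
      conv_rhs => rw [heq α]
      exact (hmono _).monotone (hα (mem_univ _))
    have e2 := (le_abs_self _).trans (hG (α 0) 0 (h α))
    rw [zero_sub, abs_neg, abs_of_neg hneg] at e2
    nlinarith [hG0 (α 0)]
  have hle : ∀ α, h α ≤ 1 := by
    obtain ⟨α, -, hα⟩ := isCompact_univ.exists_isMaxOn hne hc.continuousOn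
    suffices h α ≤ 1 from fun β => (hα (mem_univ β)).trans this
    by_contra hneg
    push Not at hneg
    have e1 : h α ≤ G (α 0) (h α) := by
      conv_lhs => rw [heq α]
      exact (hmono _).monotone (hα (mem_univ _))
    have e2 := (le_abs_self _).trans (hG (α 0) (h α) 1)
    rw [abs_of_pos (sub_pos.2 hneg)] at e2
    nlinarith [hG1 (α 0)]
  have hlex : ∀ m, ∀ α β : Word d, (∀ l < m, α l = β l) → β m < α m → h β < h α := by
    intro m
    induction m with
    | zero =>
      intro α β _ hm
      rw [heq α, heq β]
      exact ((hmono _).monotone (hle _)).trans_lt ((hlt _ _ hm).trans_le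
        ((hmono _).monotone (hge _)))
    | succ m ih =>
      intro α β hl hm
      rw [heq α, heq β, hl 0 (Nat.succ_pos m)]
      exact hmono _ (ih _ _ (fun l hl' => hl (l + 1) (by omega)) hm)
  have hcmp : ∀ α β : Word d, α ≠ β →
      ∃ m, (∀ l < m, α l = β l) ∧ (β m < α m ∨ α m < β m) := fun α β hab =>
    ⟨PiNat.firstDiff α β, fun l hl => PiNat.apply_eq_of_lt_firstDiff hl,
      (PiNat.apply_firstDiff_ne hab).symm.lt_or_gt⟩
  have hltiff : ∀ α β : Word d, h β < h α ↔ ∃ m, (∀ l < m, α l = β l) ∧ β m < α m := by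
    refine fun α β => ⟨fun hab => ?_, fun ⟨m, hm, hm'⟩ => hlex m α β hm hm'⟩
    obtain ⟨m, hm, hm' | hm'⟩ := hcmp α β (by rintro rfl; exact lt_irrefl _ hab)
    · exact ⟨m, hm, hm'⟩
    · exact absurd (hlex m β α (fun l hl => (hm l hl).symm) hm') hab.not_gt
  have hinj : Function.Injective h := by
    intro α β hab
    by_contra hne
    obtain ⟨m, hm, hm' | hm'⟩ := hcmp α β hne
    · exact (hlex m α β hm hm').ne' hab
    · exact (hlex m β α (fun l hl => (hm l hl).symm) hm').ne hab
  have hfix : ∀ (i : Fin d) (y : ℝ), G i y = y → h (fun _ => i) = y := by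
    intro i y hy
    have e1 := hG i (h fun _ => i) y
    rw [hy, show G i (h fun _ => i) = h fun _ => i from (heq fun _ => i).symm] at e1
    have e2 : |h (fun _ => i) - y| ≤ 0 := by nlinarith [abs_nonneg (h (fun _ => i) - y)]
    exact sub_eq_zero.1 (abs_eq_zero.1 (le_antisymm e2 (abs_nonneg _)))
  refine ⟨h, ⟨⟨(hc.isClosedEmbedding hinj).isEmbedding, hltiff, ?_⟩, hmono, fun i α => ?_⟩⟩
  · apply Subset.antisymm
    · refine convexHull_min ?_ (convex_Icc _ _)
      rintro _ ⟨α, rfl⟩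
      exact ⟨hge α, hle α⟩
    · rw [← segment_eq_Icc zero_le_one]
      exact segment_subset_convexHull ⟨_, hfix _ _ h0⟩ ⟨_, hfix _ _ h1⟩
  · rw [heq (prepend i α), shift_prepend]
    rfl

/-- The image of the coding consists of the points whose orbits stay in the branch intervals. -/
theorem IsCodedBy.range_eq_survivors {h : Word d → ℝ} (hh : IsCodedBy h G) (hK0 : 0 ≤ K)
    (hK1 : K < 1) (hG : ∀ i x y, |G i x - G i y| ≤ K * |x - y|) {f : ℝ → ℝ}
    (hGf : ∀ i, ∀ y ∈ Icc (0 : ℝ) 1, G i y ∈ branchInterval d i ∧ f (G i y) = y)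
    (hfG : ∀ i, ∀ x ∈ branchInterval d i, f x ∈ Icc (0 : ℝ) 1 ∧ G i (f x) = x) :
    range h = survivors d f ∧ ∀ α, f (h α) = h (shift α) := by
  have heq : ∀ α, h α = G (α 0) (h (shift α)) := fun α => by rw [hh.map_eq, prepend_shift]
  have hconj : ∀ α, f (h α) = h (shift α) := fun α => by
    rw [heq α, (hGf _ _ (hh.embedding.mem_Icc _)).2]
  refine ⟨Subset.antisymm ?_ ?_, hconj⟩
  · rintro _ ⟨α, rfl⟩ n
    have hn : f^[n] (h α) = h (shift^[n] α) := by
      induction n with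
      | zero => rfl
      | succ n ih => rw [Function.iterate_succ_apply', ih, hconj, Function.iterate_succ_apply']
    rw [hn, heq]
    exact mem_iUnion.2 ⟨_, (hGf _ _ (hh.embedding.mem_Icc _)).1⟩
  · intro x hx
    have hx' : ∀ n, ∃ i, f^[n] x ∈ branchInterval d i := fun n => mem_iUnion.1 (hx n)
    choose α hα using hx'
    -- Both x and h(α) are images under `G (α 0)`, of f(x) and of `h (shift α)`, so every step along
    -- the itinerary gains a factor K.
    have key : ∀ n, ∀ (x : ℝ) (α : Word d), (∀ m, f^[m] x ∈ branchInterval d (α m)) →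
        |x - h α| ≤ K ^ n := by
      intro n
      induction n with
      | zero =>
        intro x α hα
        have h1 := hfG _ x (hα 0)
        have h2 := hh.map_mem_Icc (α 0) h1.1
        rw [h1.2] at h2
        have h3 := hh.embedding.mem_Icc α
        rw [pow_zero, abs_le]
        exact ⟨by linarith [h2.1, h3.2], by linarith [h2.2, h3.1]⟩
      | succ n ih =>
        intro x α hα
        have h1 := ih (f x) (shift α) fun m => hα (m + 1)
        have h2 := hG (α 0) (f x) (h (shift α))
        rw [(hfG _ x (hα 0)).2, ← heq] at h2
        rw [pow_succ']
        exact h2.trans (by gcongr)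
    have h0 : |x - h α| ≤ 0 := ge_of_tendsto' (tendsto_pow_atTop_nhds_zero_of_lt_one hK0 hK1)
      fun n => key n x α hα
    exact ⟨α, (sub_eq_zero.1 (abs_eq_zero.1 (le_antisymm h0 (abs_nonneg _)))).symm⟩

end Attractor

/-! ### The branches of the example -/

section Example

variable {d k : ℕ} {ε A : ℝ} {f : ℝ → ℝ}

/-- The inverse branches of the example. -/
structure IsExampleBranches (d k : ℕ) (ε A K : ℝ) (G : Fin d → ℝ → ℝ) : Prop where
  nonneg : 0 ≤ K
  lt_one : K < 1
  holder : ∀ i, HolderClass ε k (G i)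
  deriv_pos : ∀ i x, 0 < deriv (G i) x
  deriv_le : ∀ i x, deriv (G i) x ≤ K
  affine : ∀ i : Fin d, (i : ℕ) ≠ 0 → ∀ y, G i y = (2 * d - 1 : ℝ)⁻¹ * y + 2 * i / (2 * d - 1)
  left_inv : ∀ i : Fin d, (i : ℕ) = 0 → ∀ x,
    G i (A * ((2 * d - 1) * x + posPow (k + ε) x)) = x
  right_inv : ∀ i : Fin d, (i : ℕ) = 0 → ∀ y,
    A * ((2 * d - 1) * G i y + posPow (k + ε) (G i y)) = y
  apply_zero : ∀ i : Fin d, G i 0 = 2 * i / (2 * d - 1)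
  apply_one : ∀ i : Fin d, G i 1 = (2 * i + 1) / (2 * d - 1)

theorem three_le_of_one_lt (hd : 1 < d) : (3 : ℝ) ≤ 2 * d - 1 := by
  have : (2 : ℝ) ≤ d := by exact_mod_cast hd
  linarith

/-- Replacing x^s by x_+^s extends the first branch of f to the line with derivative at least AD.
Since D^{-s} ≤ 1 forces A ≥ 1/2, and D ≥ 3, the number (AD)^{-1} is less than 1; it is a common
contraction constant because A ≤ 1 makes it at least the slope 1/D of the affine branches. -/
theorem exists_isExampleBranches (hd : 1 < d) (hk : 1 ≤ k) (h0 : 0 < ε) (h1 : ε ≤ 1)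
    (hA : A * (1 + ((2 * d - 1 : ℝ)⁻¹) ^ (k + ε)) = 1) :
    ∃ (K : ℝ) (G : Fin d → ℝ → ℝ), IsExampleBranches d k ε A K G := by
  have hD3 := three_le_of_one_lt hd
  set D : ℝ := 2 * d - 1 with hD
  have hD0 : 0 < D := by linarith
  have hk1 : (1 : ℝ) ≤ k := by exact_mod_cast hk
  set p : ℝ := D⁻¹ ^ ((k : ℝ) + ε) with hp
  have hp0 : 0 ≤ p := by positivity
  have hp1 : p ≤ 1 := Real.rpow_le_one (by positivity) (inv_le_one_of_one_le₀ (by linarith))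
    (by positivity)
  have hA0 : 0 < A := by
    by_contra hneg
    push Not at hneg
    nlinarith
  have hA1 : A ≤ 1 := by nlinarith
  have hAD : 1 < A * D := by nlinarith
  obtain ⟨n, rfl⟩ : ∃ n, k = n + 1 := ⟨k - 1, by omega⟩
  set s : ℝ := ((n + 1 : ℕ) : ℝ) + ε with hs
  have hs1 : 1 < s := by linarith
  let F : ℝ → ℝ := fun x => A * (D * x + posPow s x)
  have hFd : ∀ x, HasDerivAt F (A * (D + s * posPow (s - 1) x)) x := fun x => by
    simpa using (((hasDerivAt_id x).const_mul D).add (hasDerivAt_posPow hs1 x)).const_mul A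
  have hFc : ∀ x, A * D ≤ deriv F x := fun x => by
    rw [(hFd x).deriv]
    have : 0 ≤ s * posPow (s - 1) x := mul_nonneg (by linarith) (posPow_nonneg _ _)
    gcongr
    linarith
  have hid : HolderClass ε (n + 1) fun x : ℝ => x := .of_contDiff h1 contDiff_id
  have hF : HolderClass ε (n + 1) F :=
    ((hid.const_mul h0 h1 D).add (holderClass_posPow h0 h1 (n + 1))).const_mul h0 h1 A
  obtain ⟨T, hT, hTF, hFT, hTd⟩ := hF.exists_inverse h0 h1 (by positivity) hFc
  let G : Fin d → ℝ → ℝ := fun i => if (i : ℕ) = 0 then T else fun y => D⁻¹ * y + 2 * i / D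
  have hGz : ∀ i : Fin d, (i : ℕ) = 0 → G i = T := fun i hi => if_pos hi
  have hGa : ∀ i : Fin d, (i : ℕ) ≠ 0 → G i = fun y => D⁻¹ * y + 2 * i / D := fun i hi =>
    if_neg hi
  have hGd : ∀ i : Fin d, (i : ℕ) ≠ 0 → ∀ x, deriv (G i) x = D⁻¹ := fun i hi x => by
    rw [hGa i hi]
    simp
  refine ⟨(A * D)⁻¹, G, by positivity, inv_lt_one_of_one_lt₀ hAD, fun i => ?_, fun i x => ?_,
    fun i x => ?_, fun i hi y => by rw [hGa i hi], fun i hi x => by rw [hGz i hi]; exact hTF x,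
    fun i hi y => by rw [hGz i hi]; exact hFT y, fun i => ?_, fun i => ?_⟩
  all_goals by_cases hi : (i : ℕ) = 0
  · rw [hGz i hi]; exact hT
  · rw [hGa i hi]; exact (hid.const_mul h0 h1 _).add (.const h1 _)
  · rw [hGz i hi, (hTd x).deriv]
    have := hFc (T x)
    exact inv_pos.2 (by linarith)
  · rw [hGd i hi]; positivity
  · rw [hGz i hi, (hTd x).deriv]
    exact inv_anti₀ (by linarith) (hFc (T x))
  · rw [hGd i hi]
    exact inv_anti₀ (by linarith) (by nlinarith)
  · rw [hGz i hi, hi]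
    have : F 0 = 0 := by simp [F, posPow, Real.zero_rpow (by linarith : s ≠ 0)]
    simpa [this] using hTF 0
  · simp [hGa i hi, hD]
  · rw [hGz i hi, hi]
    have : F D⁻¹ = 1 := by
      simp only [F]
      rw [posPow_of_nonneg (by positivity), mul_inv_cancel₀ hD0.ne']
      exact hA
    have h2 := hTF D⁻¹
    rw [this] at h2
    simpa using h2
  · rw [hGa i hi, ← hD]
    field_simp
    ring

theorem branchInterval_eq (i : Fin d) : branchInterval d i =
    Icc (2 * (i : ℝ) / (2 * d - 1)) ((2 * (i : ℝ) + 1) / (2 * d - 1)) := rfl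

/-- The sign of A is not given, but the value 1 is attained at a point x ≥ 0, which forces A > 0.
Then f increases on J_1 and takes its maximum 1 at the right end 1/D. -/
theorem IsExampleMap.constant_eq (hf : IsExampleMap d k ε A f) (hd : 1 < d) (h0 : 0 < ε) :
    A * (1 + ((2 * d - 1 : ℝ)⁻¹) ^ (k + ε)) = 1 := by
  have hD3 := three_le_of_one_lt hd
  set D : ℝ := 2 * d - 1 with hD
  have hs : 0 ≤ (k : ℝ) + ε := by positivity
  let z : Fin d := ⟨0, by omega⟩
  have hJ : branchInterval d z = Icc 0 D⁻¹ := by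
    simp [branchInterval, z, ← hD]
  have hval := hf.first z rfl
  have him := hf.image z
  rw [hJ] at hval him
  have hmem : D⁻¹ ∈ Icc 0 D⁻¹ := right_mem_Icc.2 (by positivity)
  have hDval := hval _ hmem
  rw [← hD, mul_inv_cancel₀ (by linarith)] at hDval
  have hle : f D⁻¹ ≤ 1 := (him ▸ mem_image_of_mem f hmem : f D⁻¹ ∈ Icc (0 : ℝ) 1).2
  obtain ⟨x, hx, hx1⟩ : (1 : ℝ) ∈ f '' Icc 0 D⁻¹ := him ▸ right_mem_Icc.2 zero_le_one
  rw [hval x hx, ← hD] at hx1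
  have hxs : x ^ ((k : ℝ) + ε) ≤ D⁻¹ ^ ((k : ℝ) + ε) := Real.rpow_le_rpow hx.1 hx.2 hs
  have hxs0 : 0 ≤ x ^ ((k : ℝ) + ε) := Real.rpow_nonneg hx.1 _
  have hDx0 : 0 ≤ D * x := mul_nonneg (by linarith) hx.1
  have hDx : D * x ≤ 1 := by
    calc D * x ≤ D * D⁻¹ := by gcongr; exact hx.2
      _ = 1 := mul_inv_cancel₀ (by linarith)
  have hA : 0 < A := by
    by_contra hneg
    push Not at hneg
    nlinarith
  refine le_antisymm (hDval ▸ hle) ?_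
  calc (1 : ℝ) = A * (D * x + x ^ ((k : ℝ) + ε)) := hx1.symm
    _ ≤ _ := by gcongr

/-- An increasing affine map onto [0,1] sends the two ends of the interval to 0 and 1, and the
interval has length 1/D. -/
theorem IsExampleMap.eq_affine (hf : IsExampleMap d k ε A f) (hd : 1 < d) {i : Fin d}
    (hi : (i : ℕ) ≠ 0) : ∀ x ∈ branchInterval d i, f x = (2 * d - 1) * x - 2 * i := by
  have hD3 := three_le_of_one_lt hd
  obtain ⟨a, b, ha, hab⟩ := hf.affine i hi
  have him := hf.image i
  rw [branchInterval_eq] at hab him ⊢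
  set D : ℝ := 2 * d - 1 with hD
  set u : ℝ := 2 * (i : ℝ) / D with hu
  set v : ℝ := (2 * (i : ℝ) + 1) / D with hv
  have hD0 : 0 < D := by linarith
  have huv : u ≤ v := by rw [hu, hv]; gcongr; linarith
  have hum : u ∈ Icc u v := left_mem_Icc.2 huv
  have hvm : v ∈ Icc u v := right_mem_Icc.2 huv
  have h1 : 0 ≤ f u := (him ▸ mem_image_of_mem f hum : f u ∈ Icc (0 : ℝ) 1).1
  have h2 : f v ≤ 1 := (him ▸ mem_image_of_mem f hvm : f v ∈ Icc (0 : ℝ) 1).2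
  obtain ⟨x, hx, hx0⟩ : (0 : ℝ) ∈ f '' Icc u v := him ▸ left_mem_Icc.2 zero_le_one
  obtain ⟨y, hy, hy1⟩ : (1 : ℝ) ∈ f '' Icc u v := him ▸ right_mem_Icc.2 zero_le_one
  rw [hab x hx] at hx0
  rw [hab y hy] at hy1
  rw [hab u hum] at h1
  rw [hab v hvm] at h2
  have e1 : a * u + b = 0 := le_antisymm (by nlinarith [hx.1]) h1
  have e2 : a * v + b = 1 := le_antisymm h2 (by nlinarith [hy.2])
  have hDu : D * u = 2 * i := by rw [hu]; field_simp
  have hDv : D * v = 2 * i + 1 := by rw [hv]; field_simp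
  have haD : a = D := by
    have h3 : a * (D * v - D * u) = D := by linear_combination D * e2 - D * e1
    rw [hDu, hDv] at h3
    linarith
  intro t ht
  rw [hab t ht]
  subst haD
  linarith

theorem IsExampleBranches.map_mem {K : ℝ} {G : Fin d → ℝ → ℝ}
    (hG : IsExampleBranches d k ε A K G) (i : Fin d) {y : ℝ} (hy : y ∈ Icc (0 : ℝ) 1) :
    G i y ∈ branchInterval d i := by
  have hm : Monotone (G i) := (strictMono_of_deriv_pos (hG.deriv_pos i)).monotone
  rw [branchInterval_eq, ← hG.apply_zero, ← hG.apply_one]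
  exact ⟨hm hy.1, hm hy.2⟩

theorem IsExampleMap.inverse_branches (hf : IsExampleMap d k ε A f) (hd : 1 < d) {K : ℝ}
    {G : Fin d → ℝ → ℝ} (hG : IsExampleBranches d k ε A K G) (i : Fin d) :
    (∀ y ∈ Icc (0 : ℝ) 1, G i y ∈ branchInterval d i ∧ f (G i y) = y) ∧
      ∀ x ∈ branchInterval d i, f x ∈ Icc (0 : ℝ) 1 ∧ G i (f x) = x := by
  have hD3 := three_le_of_one_lt hd
  have hmem : ∀ x ∈ branchInterval d i, f x ∈ Icc (0 : ℝ) 1 := fun x hx => by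
    rw [← hf.image i]; exact mem_image_of_mem f hx
  have hpos : ∀ x ∈ branchInterval d i, 0 ≤ x := fun x hx =>
    (div_nonneg (by positivity) (by linarith)).trans hx.1
  by_cases hi : (i : ℕ) = 0
  · have hfi : ∀ x ∈ branchInterval d i, f x = A * ((2 * d - 1) * x + posPow (k + ε) x) :=
      fun x hx => by rw [hf.first i hi x hx, posPow_of_nonneg (hpos x hx)]
    refine ⟨fun y hy => ⟨hG.map_mem i hy, ?_⟩, fun x hx => ⟨hmem x hx, ?_⟩⟩
    · rw [hfi _ (hG.map_mem i hy), hG.right_inv i hi]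
    · rw [hfi x hx, hG.left_inv i hi]
  · refine ⟨fun y hy => ⟨hG.map_mem i hy, ?_⟩, fun x hx => ⟨hmem x hx, ?_⟩⟩
    · rw [hf.eq_affine hd hi _ (hG.map_mem i hy), hG.affine i hi]
      field_simp
      ring
    · rw [hf.eq_affine hd hi x hx, hG.affine i hi]
      field_simp
      ring

theorem exists_isExampleMap (hd : 1 < d) (hk : 1 ≤ k) (h0 : 0 < ε) (h1 : ε ≤ 1) :
    ∃ (A : ℝ) (f : ℝ → ℝ), IsExampleMap d k ε A f := by
  have hD3 := three_le_of_one_lt hd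
  have hp : (0 : ℝ) < 1 + ((2 * d - 1 : ℝ)⁻¹) ^ (k + ε) := by
    have : (0 : ℝ) ≤ ((2 * d - 1 : ℝ)⁻¹) ^ (k + ε) :=
      Real.rpow_nonneg (inv_nonneg.2 (by linarith)) _
    linarith
  obtain ⟨K, G, hG⟩ := exists_isExampleBranches hd hk h0 h1 (inv_mul_cancel₀ hp.ne')
  set A : ℝ := (1 + ((2 * d - 1 : ℝ)⁻¹) ^ (k + ε))⁻¹
  set D : ℝ := 2 * d - 1 with hD
  have hD0 : 0 < D := by linarith
  -- One formula serves all later branches: on `branchInterval d i` the number Dx lies in [2i,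
  -- 2i+1], so ⌊Dx/2⌋ = i.
  let f : ℝ → ℝ := fun x =>
    if x ≤ 1 / D then A * (D * x + x ^ ((k : ℝ) + ε)) else D * x - 2 * ⌊D * x / 2⌋
  have hfirst : ∀ i : Fin d, (i : ℕ) = 0 → ∀ x ∈ branchInterval d i,
      f x = A * (D * x + x ^ ((k : ℝ) + ε)) := fun i hi x hx => by
    refine if_pos (hx.2.trans_eq ?_)
    simp [hi, hD]
  have hother : ∀ i : Fin d, (i : ℕ) ≠ 0 → ∀ x ∈ branchInterval d i, f x = D * x + -(2 * i) := by
    intro i hi x hx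
    have hi1 : (1 : ℝ) ≤ i := by exact_mod_cast Nat.one_le_iff_ne_zero.2 hi
    have hx1 : 2 * (i : ℝ) ≤ D * x := by
      have := hx.1
      rwa [← hD, div_le_iff₀ hD0, mul_comm x] at this
    have hx2 : D * x ≤ 2 * i + 1 := by
      have := hx.2
      rwa [← hD, le_div_iff₀ hD0, mul_comm x] at this
    have hne : ¬ x ≤ 1 / D := by
      rw [le_div_iff₀ hD0, mul_comm x]
      linarith
    have hfl : ⌊D * x / 2⌋ = (i : ℤ) := by
      rw [Int.floor_eq_iff]
      push_cast
      constructor <;> linarith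
    simp only [f, if_neg hne, hfl]
    push_cast
    ring
  refine ⟨A, f, fun i => ?_, hfirst, fun i hi => ⟨D, -(2 * i), hD0, hother i hi⟩⟩
  have hm : StrictMono (G i) := strictMono_of_deriv_pos (hG.deriv_pos i)
  have hinv : ∀ x ∈ branchInterval d i, G i (f x) = x := by
    intro x hx
    by_cases hi : (i : ℕ) = 0
    · have hx0 : 0 ≤ x := (div_nonneg (by positivity) hD0.le).trans hx.1
      rw [hfirst i hi x hx, ← posPow_of_nonneg hx0, hG.left_inv i hi]
    · rw [hother i hi x hx, hG.affine i hi, ← hD]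
      field_simp
      ring
  apply Subset.antisymm
  · rintro _ ⟨x, hx, rfl⟩
    have hx' := hinv x hx
    rw [branchInterval_eq, ← hG.apply_zero, ← hG.apply_one, ← hx'] at hx
    exact ⟨hm.le_iff_le.1 hx.1, hm.le_iff_le.1 hx.2⟩
  · intro y hy
    have hGy := hG.map_mem i hy
    exact ⟨G i y, hGy, hm.injective (hinv _ hGy)⟩

end Example

/-! ### Words with a prefix of first letters and a tail of second letters -/

section Witness

variable {d : ℕ}

/-- The word `z…zooo…` with `n` letters `z`. -/
def witness (z o : Fin d) (n : ℕ) : Word d := splice (fun _ => z) n fun _ => o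

theorem witness_apply_of_lt (z o : Fin d) {n m : ℕ} (h : m < n) : witness z o n m = z := if_pos h

theorem initial_witness (z o : Fin d) (n N : ℕ) :
    initial (witness z o n) (n + N) = List.replicate n z ++ List.replicate N o := by
  rw [witness, initial_splice, initial_const, initial_const]

theorem witness_apply_self_ne {z o : Fin d} (hzo : z ≠ o) (n : ℕ) :
    witness z o (n + 1) n ≠ witness z o n n := by
  simp [witness, splice, hzo]

theorem witness_ne {z o : Fin d} (hzo : z ≠ o) (n : ℕ) : witness z o (n + 1) ≠ witness z o n :=
  fun h => witness_apply_self_ne hzo n (congrFun h n)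

theorem firstDiff_witness {z o : Fin d} (hzo : z ≠ o) (n : ℕ) :
    PiNat.firstDiff (witness z o (n + 1)) (witness z o n) = n := by
  refine le_antisymm (not_lt.1 fun hlt => witness_apply_self_ne hzo n
    (PiNat.apply_eq_of_lt_firstDiff hlt)) (not_lt.1 fun hlt => ?_)
  refine PiNat.apply_firstDiff_ne (witness_ne hzo n) ?_
  rw [witness_apply_of_lt z o hlt, witness_apply_of_lt z o (hlt.trans n.lt_succ_self)]

variable {h : Word d → ℝ} {G : Fin d → ℝ → ℝ} {S : Word d → Coord d → ℝ}

theorem IsCodedBy.iterate_mem_Icc (hh : IsCodedBy h G) (z : Fin d) (n : ℕ) {x : ℝ}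
    (hx : x ∈ Icc (0 : ℝ) 1) : (G z)^[n] x ∈ Icc (0 : ℝ) 1 := by
  rw [← compL_replicate]
  exact hh.compL_mem_Icc _ hx

theorem IsCodedBy.iterate_first_zero (hh : IsCodedBy h G) (hd : 0 < d) (n : ℕ) :
    (G ⟨0, hd⟩)^[n] 0 = 0 :=
  Function.iterate_fixed (hh.first_zero hd) n

/-- The partition of the scaling function at a witness, for any coordinate in which the second
branch is linear. -/
theorem IsCodedBy.endSeq_witness (hh : IsCodedBy h G) (hS : IsScalingFunction h S) (hd : 0 < d)
    {o : Fin d} {Φ : ℝ → ℝ}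
    (hΦ : ∀ x y z w, z ≠ w → Tendsto
      (fun N => ((G o)^[N] x - (G o)^[N] y) / ((G o)^[N] z - (G o)^[N] w)) atTop
        (𝓝 ((Φ x - Φ y) / (Φ z - Φ w)))) (n : ℕ) {m : ℕ} (hm : m < 2 * d) :
    endSeq (S (witness ⟨0, hd⟩ o n)) m =
      (Φ ((G ⟨0, hd⟩)^[n] (branchSeq G m)) - Φ 0) / (Φ ((G ⟨0, hd⟩)^[n] 1) - Φ 0) := by
  have h1 := (hh.tendsto_endSeq hS (witness ⟨0, hd⟩ o n) hm).comp (tendsto_add_atTop_nat n)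
  have hne : (G ⟨0, hd⟩)^[n] 1 ≠ 0 := by
    have := (hh.strictMono ⟨0, hd⟩).iterate n one_pos
    rw [hh.iterate_first_zero] at this
    exact this.ne'
  refine tendsto_nhds_unique h1 ((hΦ _ _ _ _ hne).congr fun N => ?_)
  rw [Function.comp, add_comm N n, initial_witness, relRatio_comp_iterate]
  simp only [compL_replicate, hh.iterate_first_zero]

end Witness

/-! ### Obstructions to smoothness -/

section Obstruction

variable {d k : ℕ} {ε A K : ℝ} {h : Word d → ℝ} {G : Fin d → ℝ → ℝ} {S : Word d → Coord d → ℝ}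

theorem iterate_affine_sub {g : ℝ → ℝ} {p q : ℝ} (hg : ∀ y, g y = p * y + q) (N : ℕ) (x y : ℝ) :
    g^[N] x - g^[N] y = p ^ N * (x - y) := by
  induction N with
  | zero => simp
  | succ N ih =>
    rw [Function.iterate_succ_apply', Function.iterate_succ_apply', hg, hg, pow_succ']
    linear_combination p * ih

/-- The second branch is affine, so the identity is a linearizing coordinate and S is explicit at
the witnesses. -/
theorem IsExampleBranches.endSeq_witness (hG : IsExampleBranches d k ε A K G)
    (hh : IsCodedBy h G) (hS : IsScalingFunction h S) (hd : 1 < d) (n : ℕ) {m : ℕ}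
    (hm : m < 2 * d) :
    endSeq (S (witness ⟨0, by omega⟩ ⟨1, hd⟩ n)) m =
      (G ⟨0, by omega⟩)^[n] (branchSeq G m) / (G ⟨0, by omega⟩)^[n] 1 := by
  have hD3 := three_le_of_one_lt hd
  have hp : (2 * d - 1 : ℝ)⁻¹ ≠ 0 := inv_ne_zero (by linarith)
  have := hh.endSeq_witness hS (by omega) (o := ⟨1, hd⟩) (Φ := fun x => x)
    (fun x y z w _ => tendsto_const_nhds.congr fun N => by
      rw [iterate_affine_sub (hG.affine ⟨1, hd⟩ one_ne_zero),
        iterate_affine_sub (hG.affine ⟨1, hd⟩ one_ne_zero),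
        mul_div_mul_left _ _ (pow_ne_zero N hp)]) n hm
  simpa using this

/-- There are no maps between the partitions at consecutive witnesses whose `k`-th derivatives have
variation of smaller order than expected. -/
theorem IsExampleBranches.not_forall_exists_map (hG : IsExampleBranches d k ε A K G)
    (hh : IsCodedBy h G) (hS : IsScalingFunction h S) (hd : 1 < d) (hk : 1 ≤ k)
    (hkd : k + 1 < 2 * d) (h0 : 0 < ε) (h1 : ε ≤ 1)
    (hSc : ∃ c > 0, ∀ j, c ≤ S j (.inl ⟨0, by omega⟩)) {e C : ℝ} (he : ε < e) :
    ¬ ∀ n, ∃ φ : ℝ → ℝ, ContDiffOn ℝ k φ (Icc 0 1) ∧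
      (∀ m < 2 * d, φ (endSeq (S (witness ⟨0, by omega⟩ ⟨1, hd⟩ (n + 1))) m) =
        endSeq (S (witness ⟨0, by omega⟩ ⟨1, hd⟩ n)) m) ∧
      ∀ u ∈ Icc (0 : ℝ) 1, ∀ v ∈ Icc (0 : ℝ) 1,
        |iteratedDerivWithin k φ (Icc 0 1) u - iteratedDerivWithin k φ (Icc 0 1) v| ≤
          C * ((G ⟨0, by omega⟩)^[n + 1] 1) ^ (k + e - 1) := by
  intro H
  obtain ⟨c₁, hc₁, hSc⟩ := hSc
  obtain ⟨c, hc, hvar⟩ := exists_variation_lower_bound k hk h0 h1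
  have hD3 := three_le_of_one_lt hd
  set D : ℝ := 2 * d - 1 with hD
  have hD0 : 0 < D := by linarith
  have hd0 : 0 < d := by omega
  set z : Fin d := ⟨0, hd0⟩ with hz
  set s : ℝ := (k : ℝ) + ε with hs
  have hk1 : (1 : ℝ) ≤ k := by exact_mod_cast hk
  have hlip := lipschitz_of_deriv_le (by
    obtain ⟨n, rfl⟩ : ∃ n, k = n + 1 := ⟨k - 1, by omega⟩
    exact (hG.holder z).1) (hG.deriv_pos z) (hG.deriv_le z)
  have hQ0 : ∀ n, 0 < (G z)^[n] 1 := fun n => by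
    rw [← hh.iterate_first_zero hd0 n]
    exact (hh.strictMono z).iterate n one_pos
  have hQ1 : ∀ n, (G z)^[n] 1 ≤ 1 := fun n => (hh.iterate_mem_Icc z n (by simp)).2
  -- The lower and upper bounds for the variation share the factor Q^{s-1}; after cancelling it, the
  -- left side is a positive constant and the right side tends to 0.
  have hlow : ∀ n, c * (1 / (D + 1) * c₁) ≤ C * ((G z)^[n + 1] 1) ^ (e - ε) := by
    intro n
    obtain ⟨φ, hφ, hφx, hφv⟩ := H n
    set Q := (G z)^[n + 1] 1 with hQ
    have hQpos : 0 < Q := hQ0 _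
    have hsm := hS.1 (witness z ⟨1, hd⟩ (n + 1))
    set x : ℕ → ℝ := endSeq (S (witness z ⟨1, hd⟩ (n + 1))) with hx
    set β : ℝ := Q ^ (s - 1) / D with hβ
    have hβ0 : 0 < β := div_pos (Real.rpow_pos_of_pos hQpos _) hD0
    have hFex : ∀ t, A * (D * (G z)^[n + 1] t + posPow s ((G z)^[n + 1] t)) = (G z)^[n] t :=
      fun t => by
        rw [Function.iterate_succ_apply']
        exact hG.right_inv z rfl _
    have hA0 : A ≠ 0 := by
      rintro rfl
      have := hFex 1
      rw [zero_mul] at this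
      exact (hQ0 n).ne this
    -- The extended first branch F of f maps Qx_i to T^n(b_i), T = `G z`; dividing by F(Q) = T^n(1)
    -- cancels A and leaves the normalized map.
    have hval : ∀ i ≤ k + 1, φ (x i) = (x i + β * x i ^ s) / (1 + β) := by
      intro i hi
      have hi2 : i < 2 * d := by omega
      have hxi := endSeq_mem_Icc hsm hi2
      rw [hφx i hi2, hG.endSeq_witness hh hS hd n hi2, ← hFex, ← hFex 1, ← hQ]
      have e1 : (G z)^[n + 1] (branchSeq G i) = Q * x i := by
        rw [hx, hG.endSeq_witness hh hS hd (n + 1) hi2, mul_div_cancel₀]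
        exact hQpos.ne'
      have e2 : Q ^ s = Q * (D * β) := by
        rw [hβ, mul_div_cancel₀ _ hD0.ne']
        conv_rhs => rw [← Real.rpow_one Q, ← Real.rpow_mul hQpos.le, one_mul,
          ← Real.rpow_add hQpos]
        congr 1
        ring
      rw [e1, posPow_of_nonneg hQpos.le, posPow_of_nonneg (mul_nonneg hQpos.le hxi.1),
        Real.mul_rpow hQpos.le hxi.1, e2, mul_div_mul_left _ _ hA0,
        show D * (Q * x i) + Q * (D * β) * x i ^ s = (Q * D) * (x i + β * x i ^ s) by ring,
        show D * Q + Q * (D * β) = (Q * D) * (1 + β) by ring,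
        mul_div_mul_left _ _ (mul_pos hQpos hD0).ne']
    -- Of the 2d end points, the first k+2 serve as nodes; they span at least the first interval, of
    -- length at least c₁.
    have key := hvar β _ x φ hβ0.le hφ (fun i hi => endSeq_mem_Icc hsm (by omega))
      (fun i hi => endSeq_lt_succ hsm (by omega)) hval hφv
    have hx0 : x 0 = 0 := endSeq_zero _ hd0
    have hx1 : c₁ ≤ x (k + 1) := by
      calc c₁ ≤ x 1 := by rw [hx, endSeq_one _ hd0]; exact hSc _
        _ ≤ x (k + 1) := endSeq_le hsm (by omega) hkd
    rw [hx0, sub_zero] at key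
    have hr : 0 < Q ^ (s - 1) := Real.rpow_pos_of_pos hQpos _
    have hr1 : Q ^ (s - 1) ≤ 1 := Real.rpow_le_one hQpos.le (hQ1 _) (by linarith)
    have hββ : Q ^ (s - 1) * (1 / (D + 1)) ≤ β / (1 + β) := by
      rw [hβ, mul_one_div, show Q ^ (s - 1) / D / (1 + Q ^ (s - 1) / D) =
        Q ^ (s - 1) / (D + Q ^ (s - 1)) by field_simp]
      gcongr
    have hsplit : Q ^ (k + e - 1) = Q ^ (s - 1) * Q ^ (e - ε) := by
      rw [← Real.rpow_add hQpos]
      congr 1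
      rw [hs]
      ring
    rw [hsplit] at key
    have h2 : Q ^ (s - 1) * (c * (1 / (D + 1) * c₁)) ≤ Q ^ (s - 1) * (C * Q ^ (e - ε)) := by
      calc _ = c * (Q ^ (s - 1) * (1 / (D + 1))) * c₁ := by ring
        _ ≤ c * (β / (1 + β)) * x (k + 1) := by gcongr
        _ ≤ _ := key
        _ = _ := by ring
    exact le_of_mul_le_mul_left h2 hr
  have hlim : Tendsto (fun n => C * ((G z)^[n + 1] 1) ^ (e - ε)) atTop (𝓝 0) := by
    have e1 : Tendsto (fun n => (G z)^[n + 1] 1) atTop (𝓝 0) :=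
      (tendsto_iterate_zero hG.nonneg hG.lt_one hlip (hh.first_zero hd0) 1).comp
        (tendsto_add_atTop_nat 1)
    have e2 := (e1.rpow_const (p := e - ε) (Or.inr (by linarith))).const_mul C
    rwa [Real.zero_rpow (by linarith), mul_zero] at e2
  have := ge_of_tendsto' hlim hlow
  have hpos : 0 < c * (1 / (D + 1) * c₁) := by positivity
  linarith

/-- The lengths T^n(1), T the first branch, are thus recovered from S alone and can be compared with
lengths in another realization. -/
theorem IsExampleBranches.iterate_succ_one (hG : IsExampleBranches d k ε A K G)
    (hh : IsCodedBy h G) (hS : IsScalingFunction h S) (hd : 1 < d) (n : ℕ) :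
    (G ⟨0, by omega⟩)^[n + 1] 1 = (G ⟨0, by omega⟩)^[n] 1 *
      S (witness ⟨0, by omega⟩ ⟨1, hd⟩ n) (.inl ⟨0, by omega⟩) := by
  have hd0 : 0 < d := by omega
  have hQ0 : 0 < (G ⟨0, hd0⟩)^[n] 1 := by
    rw [← hh.iterate_first_zero hd0 n]
    exact (hh.strictMono _).iterate n one_pos
  rw [← endSeq_one (S _) hd0, hG.endSeq_witness hh hS hd n (by omega), branchSeq_one G hd0,
    mul_div_cancel₀ _ hQ0.ne', Function.iterate_succ_apply]

theorem IsDvar.strictMonoOn {M : ℝ} {A₁ A₂ : Set ℝ} {φ : ℝ → ℝ} (hφ : IsDvar k M A₁ A₂ φ) :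
    StrictMonoOn φ (Icc 0 1) := by
  refine strictMonoOn_of_deriv_pos (convex_Icc _ _) hφ.contDiffOn.continuousOn fun x hx => ?_
  rw [interior_Icc] at hx
  rw [← derivWithin_of_mem_nhds (Icc_mem_nhds hx.1 hx.2)]
  exact hφ.deriv_pos x (Ioo_subset_Icc_self hx)

theorem rho_nonneg (hS : ∀ j, S j ∈ Simp d) (j j' : Word d) : 0 ≤ rho S j j' := by
  unfold rho
  split_ifs
  · rfl
  · exact Real.iSup_nonneg fun w => Finset.prod_nonneg fun t _ => ((hS _).1 _).1.le

/-- At consecutive witnesses `rho` is O(T^n(1)), T the first branch, so for any constant the set of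
maps between the two partitions, before renormalization, is already empty for some n. -/
theorem IsExampleBranches.not_realizationCondition (hG : IsExampleBranches d k ε A K G)
    (hh : IsCodedBy h G) (hS : IsScalingFunction h S) (hd : 1 < d) (hk : 1 ≤ k)
    (hkd : k + 1 < 2 * d) (h0 : 0 < ε) (h1 : ε ≤ 1)
    (hSc : ∃ c > 0, ∀ j, c ≤ S j (.inl ⟨0, by omega⟩))
    (hrho : ∃ C > 0, ∀ (n : ℕ) (j j' : Word d), j ≠ j' → PiNat.firstDiff j j' = n →
        (∀ t < n, j t = ⟨0, by omega⟩) → rho S j j' ≤ C * (G ⟨0, by omega⟩)^[n] 1)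
    {e : ℝ} (he : ε < e) : ¬ RealizationCondition k e S := by
  rintro ⟨M, hM⟩
  obtain ⟨B, hB, hrho⟩ := hrho
  obtain ⟨c₁, hc₁, hSc'⟩ := id hSc
  have hk1 : (1 : ℝ) ≤ k := by exact_mod_cast hk
  have hd0 : 0 < d := by omega
  have hzo : (⟨0, hd0⟩ : Fin d) ≠ ⟨1, hd⟩ := by simp
  -- `|M|` is used because the sign of M is unknown; B/c₁ combines the bound for `rho` with
  -- T^{n+1}(1) ≥ c₁T^n(1), where T is the first branch.
  refine hG.not_forall_exists_map hh hS hd hk hkd h0 h1 hSc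
    (C := |M| * (B / c₁) ^ (k + e - 1)) he fun n => ?_
  set j := witness (⟨0, hd0⟩ : Fin d) ⟨1, hd⟩ (n + 1) with hj
  set j' := witness (⟨0, hd0⟩ : Fin d) ⟨1, hd⟩ n with hj'
  obtain ⟨φ, hφ, -⟩ := hM j j' ⟨0, hd0⟩
  refine ⟨φ, hφ.contDiffOn, fun m hm =>
    map_endSeq (hS.1 _) (hS.1 _) hφ.strictMonoOn hφ.image_points hm, fun u hu v hv => ?_⟩
  have hr := hrho n j j' (witness_ne hzo n) (firstDiff_witness hzo n) fun t ht =>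
    witness_apply_of_lt _ _ (ht.trans n.lt_succ_self)
  have hr0 := rho_nonneg hS.1 j j'
  have hQ0 : 0 < (G ⟨0, hd0⟩)^[n] 1 := by
    rw [← hh.iterate_first_zero hd0 n]
    exact (hh.strictMono _).iterate n one_pos
  have hQ : B * (G ⟨0, hd0⟩)^[n] 1 ≤ B / c₁ * (G ⟨0, hd0⟩)^[n + 1] 1 := by
    rw [hG.iterate_succ_one hh hS hd n]
    have := hSc' j'
    calc B * (G ⟨0, hd0⟩)^[n] 1 = B / c₁ * ((G ⟨0, hd0⟩)^[n] 1 * c₁) := by field_simp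
      _ ≤ _ := by gcongr
  have hexp : 0 ≤ k + e - 1 := by linarith
  calc _ ≤ M * rho S j j' ^ (k + e - 1) := hφ.variation u hu v hv
    _ ≤ |M| * (B / c₁ * (G ⟨0, hd0⟩)^[n + 1] 1) ^ (k + e - 1) := by
      gcongr
      · exact le_abs_self M
      · exact hr.trans hQ
    _ = _ := by
      rw [Real.mul_rpow (by positivity) (hh.iterate_mem_Icc _ _ (by simp)).1]
      ring

/-- Needed because r may have a larger integer part than k; then g is C^{k+1} and a ≤ 1 suffices.
For n = k only the exponent drops, and n < k would give r ≤ n+1 ≤ k. -/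
theorem IsCr.holderClass {r a : ℝ} {g : ℝ → ℝ} (hg : IsCr r g) (ha0 : 0 < a) (ha1 : a ≤ 1)
    (hr : k + a ≤ r) : HolderClass a k g := by
  obtain ⟨n, b, hb0, hb1, hrn, hgc, hgh⟩ := hg
  rcases lt_trichotomy n k with hnk | rfl | hnk
  · have : (n : ℝ) + 1 ≤ k := by exact_mod_cast hnk
    linarith
  · rw [holderClass_iff ha0]
    refine ⟨hgc, fun R => ?_⟩
    have hab : a ≤ b := by linarith
    obtain ⟨C, hC0, hC⟩ := LocHolder.exists_bound hgh R
    refine ⟨C * (2 * R) ^ (b - a), fun x hx y hy => (hC x hx y hy).trans ?_⟩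
    rw [mul_assoc]
    gcongr
    rcases (abs_nonneg (x - y)).eq_or_lt with h | h
    · rw [← h, Real.zero_rpow hb0.ne', Real.zero_rpow ha0.ne', mul_zero]
    · calc |x - y| ^ b = |x - y| ^ (b - a) * |x - y| ^ a := by
            rw [← Real.rpow_add h, sub_add_cancel]
        _ ≤ _ := by
            gcongr
            exact abs_le.2 ⟨by linarith [hx.1, hy.2], by linarith [hx.2, hy.1]⟩
  · exact .of_contDiff ha1 (hgc.of_le (by exact_mod_cast hnk))

/-- In a coordinate linearizing the second branch of the realization, S determines the partition
points up to scale, and the inverse of the first branch becomes one fixed map carrying each scale to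
the preceding one. Rescaling it gives maps too flat for `not_forall_exists_map`. -/
theorem IsExampleBranches.not_hasRealization (hG : IsExampleBranches d k ε A K G)
    (hh : IsCodedBy h G) (hS : IsScalingFunction h S) (hd : 1 < d) (hk : 1 ≤ k)
    (hkd : k + 1 < 2 * d) (h0 : 0 < ε) (h1 : ε < 1)
    (hSc : ∃ c > 0, ∀ j, c ≤ S j (.inl ⟨0, by omega⟩))
    {e : ℝ} (he : ε < e) : ¬ HasRealization (k + e) S := by
  rintro ⟨h', hemb, hcr, hS'⟩
  have hd0 : 0 < d := by omega
  -- e may exceed 1; a Hölder exponent strictly between ε and 1, or equal to 1, is enough, and it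
  -- exists because ε < 1.
  set a := min e 1 with ha
  have ha1 : a ≤ 1 := min_le_right _ _
  have haε : ε < a := lt_min he h1
  have ha0 : 0 < a := h0.trans haε
  choose g hgr hgK hgeq using hcr
  choose K' hK' hgd using hgK
  have hgh : ∀ i, HolderClass a k (g i) := fun i =>
    (hgr i).holderClass ha0 ha1 (by linarith [min_le_left e 1])
  have hh' : IsCodedBy h' g := ⟨hemb, fun i => strictMono_of_deriv_pos fun x => (hgd i x).1, hgeq⟩
  obtain ⟨q, rfl⟩ : ∃ q, k = q + 1 := ⟨k - 1, by omega⟩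
  set z : Fin d := ⟨0, hd0⟩
  set o : Fin d := ⟨1, hd⟩
  have hfix : g o (h' fun _ => o) = h' fun _ => o := by
    rw [hgeq, show prepend o (fun _ => o) = fun _ => o by ext n; cases n <;> rfl]
  obtain ⟨Φ, hΦ, hΦpos, hΦlim⟩ := (hgh o).exists_linearizing_coordinate ha0 ha1 (hK' o)
    (fun x => (hgd o x).1) (fun x => (hgd o x).2) hfix
  have hΦm := strictMono_of_deriv_pos hΦpos
  obtain ⟨Ψ, hΨ, hΨΦ⟩ := hΦ.exists_local_inverse ha0 ha1 hΦpos
  obtain ⟨τ, hτ, hτg⟩ := (hgh z).exists_local_inverse ha0 ha1 (fun x => (hgd z x).1)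
  have hshift : HolderClass a (q + 1) fun y => y + Φ 0 :=
    .of_contDiff ha1 (contDiff_id.add contDiff_const)
  -- E is Φ∘g_z⁻¹∘Φ⁻¹ translated to fix 0; the left inverses Ψ and τ are only used over the images
  -- of [0,1].
  let E : ℝ → ℝ := fun y => Φ (τ (Ψ (y + Φ 0))) - Φ 0
  have hE : HolderClass a (q + 1) E :=
    ((hΦ.comp ha0 ha1 (hτ.comp ha0 ha1 (hΨ.comp ha0 ha1 hshift (hshift.contDiff_one ha0))
      ((hΨ.comp ha0 ha1 hshift (hshift.contDiff_one ha0)).contDiff_one ha0))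
      ((hτ.comp ha0 ha1 (hΨ.comp ha0 ha1 hshift (hshift.contDiff_one ha0))
      ((hΨ.comp ha0 ha1 hshift (hshift.contDiff_one ha0)).contDiff_one ha0)).contDiff_one
        ha0))).sub ha0 ha1 (.const ha1 _)
  let Z : ℕ → ℝ := fun n => Φ ((g z)^[n] 1) - Φ 0
  have hI1 : (1 : ℝ) ∈ Icc (0 : ℝ) 1 := by simp
  have hZ0 : ∀ n, 0 < Z n := fun n => by
    refine sub_pos.2 (hΦm ?_)
    rw [← hh'.iterate_first_zero hd0 n]
    exact (hh'.strictMono _).iterate n one_pos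
  have hEnd := fun (n : ℕ) {m : ℕ} (hm : m < 2 * d) => hh'.endSeq_witness hS' hd0 hΦlim n hm
  have hpt : ∀ n, ∀ m < 2 * d, Z n * endSeq (S (witness z o n)) m =
      Φ ((g z)^[n] (branchSeq g m)) - Φ 0 := fun n m hm => by
    rw [hEnd n hm]
    exact mul_div_cancel₀ _ (hZ0 n).ne'
  have hmap : ∀ n, ∀ m < 2 * d, E (Z (n + 1) * endSeq (S (witness z o (n + 1))) m) =
      Z n * endSeq (S (witness z o n)) m := fun n m hm => by
    rw [hpt _ m hm, hpt _ m hm]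
    simp only [E, sub_add_cancel]
    have hb := hh'.branchSeq_mem_Icc m
    rw [hΨΦ _ (hh'.iterate_mem_Icc z (n + 1) hb), Function.iterate_succ_apply',
      hτg _ (hh'.iterate_mem_Icc z n hb)]
  have hZS : ∀ n, Z (n + 1) = Z n * S (witness z o n) (.inl z) := fun n => by
    have := hpt n 1 (by omega)
    rw [endSeq_one _ hd0, branchSeq_one g hd0] at this
    rw [this]
    simp only [Z, Function.iterate_succ_apply]
    rfl
  -- Both sequences have the successive ratios given by the first coordinate of S at the witnesses.
  have hZQ : ∀ n, Z n = Z 0 * (G z)^[n] 1 := by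
    intro n
    induction n with
    | zero => simp
    | succ n ih => rw [hZS, ih, hG.iterate_succ_one hh hS hd n, mul_assoc]
  have hZmono : ∀ n, Z (n + 1) ≤ Z n := fun n => by
    rw [hZS]
    exact mul_le_of_le_one_right (hZ0 n).le ((hS.1 _).1 _).2.le
  have hZle : ∀ n, Z n ≤ Z 0 := fun n => antitone_nat_of_succ_le hZmono n.zero_le
  have hEc : ContDiff ℝ (q + 1 : ℕ) E := hE.contDiff ha0
  obtain ⟨B, hB0, hB⟩ := ((holderClass_iff ha0).1 hE).2.exists_bound (Z 0)
  refine hG.not_forall_exists_map hh hS hd hk hkd h0 h1.le hSc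
    (C := B * Z 0 ^ (((q + 1 : ℕ) : ℝ) + a - 1)) haε fun n => ?_
  have hcomp : ContDiff ℝ (q + 1 : ℕ) fun x => E (Z (n + 1) * x) :=
    hEc.comp (contDiff_const.mul contDiff_id)
  have hφc : ContDiff ℝ (q + 1 : ℕ) fun x => (Z n)⁻¹ * E (Z (n + 1) * x) :=
    contDiff_const.mul hcomp
  refine ⟨fun x => (Z n)⁻¹ * E (Z (n + 1) * x), hφc.contDiffOn, fun m hm => ?_,
    fun u hu v hv => ?_⟩
  · beta_reduce
    rw [hmap n m hm, inv_mul_cancel_left₀ (hZ0 n).ne']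
  · have hder : ∀ t ∈ Icc (0 : ℝ) 1,
        iteratedDerivWithin (q + 1) (fun x => (Z n)⁻¹ * E (Z (n + 1) * x)) (Icc 0 1) t =
          (Z n)⁻¹ * (Z (n + 1) ^ (q + 1) * iteratedDeriv (q + 1) E (Z (n + 1) * t)) := by
      intro t ht
      rw [iteratedDerivWithin_eq_iteratedDeriv (uniqueDiffOn_Icc one_pos) hφc.contDiffAt ht,
        iteratedDeriv_const_mul_field, iteratedDeriv_comp_const_mul hEc]
    have hmem : ∀ t ∈ Icc (0 : ℝ) 1, Z (n + 1) * t ∈ Icc (-Z 0) (Z 0) := fun t ht => by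
      have h2 : Z (n + 1) * t ≤ Z (n + 1) := mul_le_of_le_one_right (hZ0 _).le ht.2
      have h3 : 0 ≤ Z (n + 1) * t := mul_nonneg (hZ0 _).le ht.1
      exact ⟨by linarith [hZ0 0], h2.trans (hZle _)⟩
    rw [hder u hu, hder v hv, ← mul_sub, ← mul_sub, abs_mul, abs_mul,
      abs_of_pos (inv_pos.2 (hZ0 n)), abs_of_pos (pow_pos (hZ0 (n + 1)) _)]
    have hZn := hZ0 (n + 1)
    have huv : |Z (n + 1) * u - Z (n + 1) * v| ≤ Z (n + 1) := by
      rw [← mul_sub, abs_mul, abs_of_pos hZn]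
      exact mul_le_of_le_one_right hZn.le
        (abs_le.2 ⟨by linarith [hu.1, hv.2], by linarith [hu.2, hv.1]⟩)
    -- With k = q+1, differentiating k times yields Z_{n+1}^k, the Hölder bound Z_{n+1}^a, and 1/Z_n
    -- ≤ 1/Z_{n+1} costs one power.
    calc _ ≤ (Z (n + 1))⁻¹ * (Z (n + 1) ^ (q + 1) * (B * Z (n + 1) ^ a)) := by
          gcongr
          · exact hZmono n
          · refine (hB _ (hmem u hu) _ (hmem v hv)).trans ?_
            gcongr
      _ = B * Z (n + 1) ^ (((q + 1 : ℕ) : ℝ) + a - 1) := by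
          rw [Real.rpow_sub hZn, Real.rpow_add hZn, Real.rpow_one, Real.rpow_natCast]
          field_simp
      _ = _ := by
          rw [hZQ (n + 1), Real.mul_rpow (hZ0 0).le (hh.iterate_mem_Icc z _ hI1).1, mul_assoc]

end Obstruction

end CantorScaling

theorem mainTheorem4 (d k : ℕ) (hk : 1 ≤ k) (hkd : k + 1 < 2 * d) (ε : ℝ) (hε₀ : 0 < ε)
    (hε₁ : ε < 1) :
    (∃ (A : ℝ) (f : ℝ → ℝ), IsExampleMap d k ε A f) ∧
    ∀ (A : ℝ) (f : ℝ → ℝ), IsExampleMap d k ε A f →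
      ∃ h : Word d → ℝ,
        IsCantorEmbedding h ∧ Set.range h = survivors d f ∧ (∀ α, f (h α) = h (shift α)) ∧
        IsCrEmbedding (k + ε) h ∧
        ∃ S : Word d → Coord d → ℝ,
          IsScalingFunction h S ∧
          ∀ ε₁ : ℝ, ε < ε₁ → ¬ HasRealization (k + ε₁) S ∧ ¬ RealizationCondition k ε₁ S := by
  -- The bounds on k leave at least two letters, one for the nonlinear branch and one for an affine
  -- branch.
  have hd : 1 < d := by omega
  have hd0 : 0 < d := by omega
  refine ⟨exists_isExampleMap hd hk hε₀ hε₁.le, fun A f hf => ?_⟩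
  have hD3 := three_le_of_one_lt hd
  obtain ⟨K, G, hG⟩ := exists_isExampleBranches hd hk hε₀ hε₁.le (hf.constant_eq hd hε₀)
  have hG1 : ∀ i, HolderClass ε 1 (G i) := fun i => (hG.holder i).of_le hε₀ hε₁.le hk
  have hlip : ∀ i x y, |G i x - G i y| ≤ K * |x - y| := fun i =>
    lipschitz_of_deriv_le (hG1 i).1 (hG.deriv_pos i) (hG.deriv_le i)
  obtain ⟨h, hh⟩ := exists_isCodedBy hd0 hG.nonneg hG.lt_one hlip
    (fun i => strictMono_of_deriv_pos (hG.deriv_pos i)) (by simp [hG.apply_zero])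
    (by
      rw [hG.apply_one, div_eq_one_iff_eq (by linarith)]
      simp only
      rw [Nat.cast_sub (Nat.one_le_of_lt hd)]
      push_cast
      ring)
    (fun i j hij => by
      have : (i : ℝ) + 1 ≤ j := by exact_mod_cast hij
      rw [hG.apply_one, hG.apply_zero]
      gcongr
      linarith)
  obtain ⟨hrange, hconj⟩ := hh.range_eq_survivors hG.nonneg hG.lt_one hlip
    (fun i => (hf.inverse_branches hd hG i).1) (fun i => (hf.inverse_branches hd hG i).2)
  obtain ⟨S, hS, hSc, hrho⟩ := hh.exists_scalingFunction hε₀ hε₁.le hd hG1 hG.nonneg hG.lt_one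
    hG.deriv_pos hG.deriv_le
  refine ⟨h, hh.embedding, hrange, hconj, fun i => ⟨G i, ?_, ⟨K, hG.lt_one, fun x =>
    ⟨hG.deriv_pos i x, hG.deriv_le i x⟩⟩, hh.map_eq i⟩, S, hS, fun ε₁ hε => ⟨?_, ?_⟩⟩
  · obtain ⟨h1, h2⟩ := (holderClass_iff hε₀).1 (hG.holder i)
    exact ⟨k, ε, hε₀, hε₁.le, rfl, h1, h2⟩
  · exact hG.not_hasRealization hh hS hd hk hkd hε₀ hε₁ hSc hε
  · exact hG.not_realizationCondition hh hS hd hk hkd hε₀ hε₁.le hSc hrho hε
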